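/- Let $N$ be an odd positive integer. There exist real polynomials $x(t), y(t), z(t)$ with $$\deg x = 3,\qquad \deg y = N+2\left\lfloor \tfrac N4\right\rfloor+1,\qquad \deg z = N+2\left\lfloor \tfrac{N+1}4\right\rfloor$$ such that the plane curve $t\mapsto (x(t),y(t))$, $t\in\mathbb R$, has exactly $N$ crossing points (points of the plane that are reached at two different real parameters), and there are real numbers $$s_1<\cdots<s_N<t_1<\cdots<t_N$$ which are the parameters of these crossing points: for real $a<b$, one has $(x(a),y(a))=(x(b),y(b))$ if and only if $(a,b)=(s_i,t_i)$ for some $i\in\{1,\dots,N\}$. At each of these points the two branches cross transversally, that is, $x'(s_i)y'(t_i)-x'(t_i)y'(s_i)\neq 0$. Moreover $$(-1)^i\bigl(z(t_i)-z(s_i)\bigr)>0,\qquad i=1,\dots,N.$$ -/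

import Mathlib

open Polynomial

/-- The point with parameter `t` of the plane curve `t ↦ (x(t), y(t))`. -/
noncomputable def planePoint (x y : ℝ[X]) (t : ℝ) : ℝ × ℝ :=
  (x.eval t, y.eval t)

/-- The crossing points of the plane curve `(x, y)`: the points of the plane through which the
curve passes at two different parameters, whatever the directions of the two branches. -/
def crossingPoints (x y : ℝ[X]) : Set (ℝ × ℝ) :=
  {p | ∃ s t : ℝ, s ≠ t ∧ planePoint x y s = p ∧ planePoint x y t = p}

/-- The velocity vectors of the plane curve `(x, y)` at the parameters `s` and `t` are linearly
independent; at a crossing point with parameters `s`, `t` the two branches then meet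
transversally. -/
def TransverseAt (x y : ℝ[X]) (s t : ℝ) : Prop :=
  (derivative x).eval s * (derivative y).eval t
    - (derivative x).eval t * (derivative y).eval s ≠ 0

open Filter Topology Set

/-! Write N = 2n + 1 and take x = 3t - 4t^3, so that x(sin α) = sin 3α. Parameters a < b have equal
x exactly when a = sin(θ - π/3) and b = sin(θ + π/3) with |θ| < π/2, and the crossings are the zeros
of f(θ) = y(b) - y(a). With y a combination of Chebyshev polynomials T_m, m even and not divisible
by 3, f can be any sine sum on the frequencies m. Those used are D - 6l, 0 ≤ l ≤ n, with D = deg y.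

The height comes from f itself: cos 3θ · f' + D sin 3θ · f has no term of frequency D + 3, and what
is left is z(b) - z(a) for some z of degree 6n + 3 - D. At a zero of f it equals cos 3θ · f', so its
signs alternate as soon as the zeros of f are simple and lie in (-π/6, π/6).

It remains to find f with exactly N zeros in (-π/2, π/2), simple and close to 0. In the variable 3θ,
`contactFun` gives a sum f_n on these frequencies with a zero of order N at 0 and positive on (0,
3π/2), because f_{j+1}' is a positive multiple of sin · f_j (`contactFun_pos`). The functions cos^k
· f_{n-k} use the same frequencies and vanish to order N - 2k. Adding small multiples of them splits
the zero of f_n into N simple ones (`exists_combination_with_simple_roots`). -/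

/-! ### Counting zeros on an interval by Rolle's theorem, with multiplicity -/

theorem card_roots_filter_le_derivative (p : ℝ[X]) (I : Set ℝ) (hI : I.OrdConnected)
    [DecidablePred (· ∈ I)] :
    (p.roots.filter (· ∈ I)).card ≤ (p.derivative.roots.filter (· ∈ I)).card + 1 := by
  rcases eq_or_ne (derivative p) 0 with hp' | hp'
  · rw [eq_C_of_derivative_eq_zero hp']
    simp
  have hp : p ≠ 0 := ne_of_apply_ne derivative (by rwa [derivative_zero])
  set A := p.roots.filter (· ∈ I) with hA
  set B := p.derivative.roots.filter (· ∈ I) with hB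
  have memA : ∀ x, x ∈ A ↔ p.eval x = 0 ∧ x ∈ I := fun x ↦ by
    rw [hA, Multiset.mem_filter, mem_roots hp, IsRoot]
  have memB : ∀ x, x ∈ B ↔ p.derivative.eval x = 0 ∧ x ∈ I := fun x ↦ by
    rw [hB, Multiset.mem_filter, mem_roots hp', IsRoot]
  -- Rolle's zeros lie strictly between neighbouring zeros of `p`, hence are new; `hcount` below
  -- adds those inherited from multiple zeros.
  have hcard : A.toFinset.card ≤ (B.toFinset \ A.toFinset).card + 1 := by
    refine Finset.card_le_sdiff_of_interleaved fun x hx y hy hxy _ => ?_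
    rw [Multiset.mem_toFinset, memA] at hx hy
    obtain ⟨z, hz1, hz2⟩ := exists_deriv_eq_zero hxy p.continuousOn (hx.1.trans hy.1.symm)
    refine ⟨z, ?_, hz1⟩
    rw [Multiset.mem_toFinset, memB, ← p.deriv]
    exact ⟨hz2, hI.out hx.2 hy.2 (Ioo_subset_Icc_self hz1)⟩
  have hcount : ∀ x, A.count x - 1 ≤ B.count x := fun x ↦ by
    by_cases hx : x ∈ I
    · rw [hA, hB, Multiset.count_filter_of_pos hx, Multiset.count_filter_of_pos hx, count_roots,
        count_roots]
      exact rootMultiplicity_sub_one_le_derivative_rootMultiplicity _ _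
    · rw [hA, Multiset.count_filter_of_neg hx]
      exact Nat.zero_le _
  calc
    A.card = ∑ x ∈ A.toFinset, A.count x := (Multiset.toFinset_sum_count_eq _).symm
    _ = ∑ x ∈ A.toFinset, (A.count x - 1 + 1) :=
      (Eq.symm <| Finset.sum_congr rfl fun _ hx => tsub_add_cancel_of_le <|
        Nat.succ_le_iff.2 <| Multiset.count_pos.2 <| Multiset.mem_toFinset.1 hx)
    _ = (∑ x ∈ A.toFinset, (A.count x - 1)) + A.toFinset.card := by
      simp only [Finset.sum_add_distrib, Finset.card_eq_sum_ones]
    _ ≤ (∑ x ∈ A.toFinset, B.count x) + ((B.toFinset \ A.toFinset).card + 1) :=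
      add_le_add (Finset.sum_le_sum fun x _ => hcount x) hcard
    _ ≤ (∑ x ∈ A.toFinset, B.count x) + ((∑ x ∈ B.toFinset \ A.toFinset, B.count x) + 1) := by
      simp only [Finset.card_eq_sum_ones]
      gcongr with x hx
      rw [Nat.succ_le_iff, Multiset.count_pos, ← Multiset.mem_toFinset]
      exact (Finset.mem_sdiff.1 hx).1
    _ = B.card + 1 := by
      rw [← add_assoc, ← Finset.sum_union Finset.disjoint_sdiff, Finset.union_sdiff_self_eq_union,
        ← Multiset.toFinset_sum_count_eq, ← Finset.sum_subset Finset.subset_union_right]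
      intro x _ hx₂
      simpa only [Multiset.mem_toFinset, Multiset.count_eq_zero] using hx₂

theorem card_roots_filter_le_of_iterate_derivative_ne_zero (m : ℕ) (I : Set ℝ)
    (hI : I.OrdConnected) [DecidablePred (· ∈ I)] (p : ℝ[X])
    (h : ∀ x ∈ I, (derivative^[m] p).eval x ≠ 0) :
    (p.roots.filter (· ∈ I)).card ≤ m := by
  induction m generalizing p with
  | zero =>
    rw [Nat.le_zero, Multiset.card_eq_zero, Multiset.filter_eq_nil]
    exact fun x hx hxI ↦ h x hxI (isRoot_of_mem_roots hx)
  | succ m ih =>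
    exact (card_roots_filter_le_derivative p I hI).trans (Nat.succ_le_succ (ih _ h))

/-- If the `m`-th derivative does not vanish on an interval and the polynomial has `m` zeros there,
then these are all its zeros on the interval, and they are simple. -/
theorem roots_simple_of_iterate_derivative_ne_zero (m : ℕ) (I : Set ℝ)
    (hI : I.OrdConnected) (p : ℝ[X]) (hp : p ≠ 0)
    (h : ∀ x ∈ I, (derivative^[m] p).eval x ≠ 0) (s : Finset ℝ) (hs : s.card = m)
    (hsI : ∀ x ∈ s, x ∈ I ∧ p.eval x = 0) :
    (∀ x ∈ I, p.eval x = 0 → x ∈ s) ∧ ∀ x ∈ s, p.derivative.eval x ≠ 0 := by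
  classical
  have hle := card_roots_filter_le_of_iterate_derivative_ne_zero m I hI p h
  set A := p.roots.filter (· ∈ I) with hA
  have memA : ∀ x, x ∈ A ↔ p.eval x = 0 ∧ x ∈ I := fun x ↦ by
    rw [hA, Multiset.mem_filter, mem_roots hp, IsRoot]
  have hsA : s.val ≤ A := (Multiset.le_iff_subset s.nodup).2 fun x hx ↦
    (memA x).2 (hsI x hx).symm
  have hEq : s.val = A := Multiset.eq_of_le_of_card_le hsA (hle.trans hs.ge)
  refine ⟨fun x hxI hx ↦ ?_, fun x hx hd ↦ ?_⟩
  · have : x ∈ A := (memA x).2 ⟨hx, hxI⟩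
    rwa [← hEq] at this
  · have hnd : A.Nodup := hEq ▸ s.nodup
    have h1 : A.count x ≤ 1 := Multiset.nodup_iff_count_le_one.1 hnd x
    rw [hA, Multiset.count_filter_of_pos (hsI x hx).1, count_roots] at h1
    have h2 : 1 < p.rootMultiplicity x :=
      (one_lt_rootMultiplicity_iff_isRoot hp).2 ⟨(hsI x hx).2, hd⟩
    omega

/-! ### Splitting a multiple zero by a small perturbation -/

/-- A combination of functions, each negligible near `0` compared to the next one, can be made to
alternate in sign, with the first coefficient as close to `1` and the others as small as wanted. -/
theorem exists_alternating_combination (g : ℕ → ℝ → ℝ) (δ : ℝ)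
    (hδ : 0 < δ) (n : ℕ) (hpos : ∀ k ≤ n, ∀ᶠ t in 𝓝[>] (0 : ℝ), 0 < g k t)
    (ho : ∀ k ≤ n, ∀ j < k, g j =o[𝓝[>] (0 : ℝ)] g k) (U : Set (ℕ → ℝ))
    (hU : U ∈ 𝓝 (Pi.single 0 1 : ℕ → ℝ)) :
    ∃ c ∈ U, (∀ j, n < j → c j = 0) ∧ ∃ t : ℕ → ℝ, (∀ k ≤ n, t k ∈ Ioo 0 δ) ∧
      (∀ k < n, t (k + 1) < t k) ∧
      ∀ k ≤ n, 0 < (-1 : ℝ) ^ k * ∑ j ∈ Finset.range (n + 1), c j * g j (t k) := by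
  have hδ' : ∀ᶠ t in 𝓝[>] (0 : ℝ), t ∈ Ioo 0 δ := Ioo_mem_nhdsGT hδ
  induction n generalizing U with
  | zero =>
    obtain ⟨t, ht, htδ⟩ := ((hpos 0 le_rfl).and hδ').exists
    refine ⟨_, mem_of_mem_nhds hU, fun j hj ↦ by simp [hj.ne'], fun _ ↦ t, fun _ _ ↦ htδ,
      fun k hk ↦ absurd hk (by simp), fun k hk ↦ ?_⟩
    obtain rfl : k = 0 := by omega
    simpa using ht
  | succ n ih =>
    obtain ⟨c, hcU, hc0, t, htδ, hmono, hsign⟩ := ih (fun k hk ↦ hpos k (by omega))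
      (fun k hk ↦ ho k (by omega)) (interior U) (interior_mem_nhds.2 hU)
    have hUc : U ∈ 𝓝 c := mem_interior_iff_mem_nhds.1 hcU
    -- The new coefficient `s` is taken small first, to stay in `U` and keep the signs already
    -- obtained; only then is the new point `τ` taken so close to 0 that g_{n+1} dominates.
    let c' : ℝ → ℕ → ℝ := fun s ↦ Function.update c (n + 1) ((-1) ^ (n + 1) * s)
    have hc'0 : c' 0 = c := by
      simp only [c', mul_zero]
      rw [← hc0 (n + 1) (by omega), Function.update_eq_self]
    have hc'cont : Continuous c' :=
      continuous_const.update (n + 1) (continuous_const.mul continuous_id)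
    have hsum : ∀ s x, ∑ j ∈ Finset.range (n + 1 + 1), c' s j * g j x =
        ∑ j ∈ Finset.range (n + 1), c j * g j x + (-1) ^ (n + 1) * s * g (n + 1) x := by
      intro s x
      rw [Finset.sum_range_succ]
      congr 1
      · refine Finset.sum_congr rfl fun j hj ↦ ?_
        rw [Finset.mem_range] at hj
        simp only [c']
        rw [Function.update_of_ne (by omega)]
      · simp only [c', Function.update_self]
    have hU' : ∀ᶠ s in 𝓝 (0 : ℝ), c' s ∈ U :=
      hc'cont.continuousAt.eventually_mem (by rwa [hc'0])
    have hsg : ∀ᶠ s in 𝓝 (0 : ℝ), ∀ k ∈ Finset.range (n + 1),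
        0 < (-1 : ℝ) ^ k * (∑ j ∈ Finset.range (n + 1), c j * g j (t k) +
          (-1) ^ (n + 1) * s * g (n + 1) (t k)) := by
      rw [eventually_all_finset]
      intro k hk
      rw [Finset.mem_range] at hk
      have hcont : Continuous fun s : ℝ ↦ (-1 : ℝ) ^ k *
        (∑ j ∈ Finset.range (n + 1), c j * g j (t k) + (-1) ^ (n + 1) * s * g (n + 1) (t k)) := by
        fun_prop
      refine hcont.continuousAt.tendsto.eventually_const_lt ?_
      simpa using hsign k (by omega)
    obtain ⟨s, ⟨hsU, hs⟩, hs0⟩ := (((hU'.and hsg).filter_mono nhdsWithin_le_nhds).and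
      (self_mem_nhdsWithin (a := (0 : ℝ)) (s := Ioi 0))).exists
    have hs0 : 0 < s := hs0
    have hlo : (fun x ↦ ∑ j ∈ Finset.range (n + 1), c j * g j x) =o[𝓝[>] (0 : ℝ)] g (n + 1) :=
      Asymptotics.IsLittleO.fun_sum fun j hj ↦
        (ho (n + 1) le_rfl j (Finset.mem_range.1 hj)).const_mul_left _
    obtain ⟨τ, ⟨hτ, hτpos⟩, hτ1⟩ := (((hlo.def (half_pos hs0)).and (hpos (n + 1) le_rfl)).and
      (Ioo_mem_nhdsGT (lt_min hδ (htδ n le_rfl).1))).exists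
    rw [Real.norm_eq_abs, Real.norm_eq_abs, abs_of_pos hτpos] at hτ
    have htn : ∀ k ≤ n, Function.update t (n + 1) τ k = t k := fun k hk ↦
      Function.update_of_ne (by omega) _ _
    refine ⟨c' s, hsU, fun j hj ↦ ?_, Function.update t (n + 1) τ, fun k hk ↦ ?_, fun k hk ↦ ?_,
      fun k hk ↦ ?_⟩
    · simp only [c']
      rw [Function.update_of_ne (by omega), hc0 j (by omega)]
    · rcases hk.lt_or_eq with h | rfl
      · rw [htn k (by omega)]
        exact htδ k (by omega)
      · rw [Function.update_self]
        exact ⟨hτ1.1, hτ1.2.trans_le (min_le_left _ _)⟩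
    · rcases (Nat.lt_succ_iff.1 hk).lt_or_eq with h | rfl
      · rw [htn k (by omega), htn (k + 1) (by omega)]
        exact hmono k h
      · rw [htn k le_rfl, Function.update_self]
        exact hτ1.2.trans_le (min_le_right _ _)
    · rw [hsum]
      rcases hk.lt_or_eq with h | rfl
      · rw [htn k (by omega)]
        exact hs k (Finset.mem_range.2 h)
      · rw [Function.update_self]
        set G := ∑ j ∈ Finset.range (n + 1), c j * g j τ
        have h1 : (-1 : ℝ) ^ (n + 1) * (G + (-1) ^ (n + 1) * s * g (n + 1) τ) =
            (-1 : ℝ) ^ (n + 1) * G + s * g (n + 1) τ := by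
          have : (-1 : ℝ) ^ (n + 1) * (-1) ^ (n + 1) = 1 := by
            rw [← mul_pow]; simp
          linear_combination (s * g (n + 1) τ) * this
        have h2 : |(-1 : ℝ) ^ (n + 1) * G| = |G| := by simp [abs_mul]
        have h3 := neg_abs_le ((-1 : ℝ) ^ (n + 1) * G)
        rw [h2] at h3
        rw [h1]
        nlinarith [mul_pos hs0 hτpos]

theorem eval_isLittleO_of_lt (r r' : ℝ[X]) (h' : r'.eval 0 ≠ 0) {a b : ℕ} (hab : b < a) :
    (fun u ↦ (X ^ a * r : ℝ[X]).eval u) =o[𝓝[>] (0 : ℝ)] fun u ↦ (X ^ b * r' : ℝ[X]).eval u := by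
  have h1 : (fun u : ℝ ↦ u ^ a) =o[𝓝[>] (0 : ℝ)] fun u ↦ u ^ b :=
    (Asymptotics.isLittleO_pow_pow hab).mono nhdsWithin_le_nhds
  have h2 : (fun u : ℝ ↦ r.eval u) =O[𝓝[>] (0 : ℝ)] fun u ↦ r'.eval u := by
    refine Asymptotics.IsBigO.mono ?_ nhdsWithin_le_nhds
    refine (r.continuous.continuousAt.isBigO_one ℝ).trans ?_
    exact (Asymptotics.isBigO_const_left_iff_pos_le_norm one_ne_zero).2
      ⟨‖r'.eval 0‖ / 2, by positivity, (r'.continuous.norm.continuousAt.tendsto.eventually_const_lt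
        (half_lt_self (norm_pos_iff.2 h'))).mono fun _ h ↦ h.le⟩
  simpa using h1.mul_isBigO h2

theorem eval_pos_near_zero (r : ℝ[X]) (h : 0 < r.eval 0) (a : ℕ) :
    ∀ᶠ u in 𝓝[>] (0 : ℝ), 0 < (X ^ a * r : ℝ[X]).eval u := by
  filter_upwards [(r.continuous.continuousAt.tendsto.eventually_const_lt h).filter_mono nhdsWithin_le_nhds,
    self_mem_nhdsWithin] with u hu hu0
  have : 0 < u := hu0
  simp only [eval_mul, eval_pow, eval_X]
  positivity

theorem iterate_derivative_X_pow_mul_eval_zero (m : ℕ) (r : ℝ[X]) :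
    (derivative^[m] (X ^ m * r)).eval 0 = m.factorial * r.eval 0 := by
  rw [← coeff_zero_eq_eval_zero, coeff_iterate_derivative, ← coeff_zero_eq_eval_zero]
  simp [Nat.descFactorial_self, coeff_X_pow_mul']

/-- The lower orders of vanishing of the p_k force n sign changes to the right of 0; oddness mirrors
them, and 0 itself is a zero. Near 0 the derivative of order 2n + 1 stays positive, so there are no
further zeros and all are simple. Away from 0, compactness preserves the positivity of p_0. -/
theorem exists_combination_with_simple_roots (n : ℕ) (p r : ℕ → ℝ[X])
    (hp : ∀ k ≤ n, p k = X ^ (2 * (n - k) + 1) * r k) (hr : ∀ k ≤ n, 0 < (r k).eval 0)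
    (hodd : ∀ k ≤ n, ∀ u, (p k).eval (-u) = -(p k).eval u)
    (hpos : ∀ u ∈ Ioc (0 : ℝ) 1, 0 < (p 0).eval u) (δ : ℝ) (hδ : 0 < δ) (U : Set (ℕ → ℝ))
    (hU : U ∈ 𝓝 (Pi.single 0 1 : ℕ → ℝ)) :
    ∃ c ∈ U, ∃ s : Finset ℝ, s.card = 2 * n + 1 ∧ (∀ u ∈ s, |u| < δ) ∧
      ∀ Y : ℝ[X], Y = ∑ k ∈ Finset.range (n + 1), C (c k) * p k →
      (∀ u ∈ Icc (-1 : ℝ) 1, Y.eval u = 0 → u ∈ s) ∧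
      ∀ u ∈ s, Y.eval u = 0 ∧ Y.derivative.eval u ≠ 0 := by
  set m := 2 * n + 1 with hm
  let Y : (ℕ → ℝ) → ℝ[X] := fun c ↦ ∑ k ∈ Finset.range (n + 1), C (c k) * p k
  have hYe : Y (Pi.single 0 1) = p 0 := by
    simp only [Y]
    rw [Finset.sum_range_succ', Finset.sum_eq_zero]
    · simp
    · intro k _
      simp
  have hYeval : ∀ c u, (Y c).eval u = ∑ k ∈ Finset.range (n + 1), c k * (p k).eval u := by
    intro c u
    simp [Y, eval_finsetSum]
  have hYder : ∀ c u, (derivative^[m] (Y c)).eval u =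
      ∑ k ∈ Finset.range (n + 1), c k * (derivative^[m] (p k)).eval u := by
    intro c u
    simp [Y, eval_finsetSum, iterate_derivative_sum, iterate_derivative_C_mul]
  have hYodd : ∀ c u, (Y c).eval (-u) = -(Y c).eval u := by
    intro c u
    rw [hYeval, hYeval, ← Finset.sum_neg_distrib]
    refine Finset.sum_congr rfl fun k hk ↦ ?_
    rw [hodd k (Nat.lt_succ_iff.1 (Finset.mem_range.1 hk)), mul_neg]
  have hcont1 : Continuous fun q : (ℕ → ℝ) × ℝ ↦ (Y q.1).eval q.2 := by
    simp only [hYeval]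
    refine continuous_finsetSum _ fun k _ ↦ ?_
    exact ((continuous_apply k).comp continuous_fst).mul ((p k).continuous.comp continuous_snd)
  have hcont2 : Continuous fun q : (ℕ → ℝ) × ℝ ↦ (derivative^[m] (Y q.1)).eval q.2 := by
    simp only [hYder]
    refine continuous_finsetSum _ fun k _ ↦ ?_
    exact ((continuous_apply k).comp continuous_fst).mul
      ((derivative^[m] (p k)).continuous.comp continuous_snd)
  have hder0 : 0 < (derivative^[m] (p 0)).eval 0 := by
    rw [hp 0 (Nat.zero_le n), Nat.sub_zero, iterate_derivative_X_pow_mul_eval_zero]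
    exact mul_pos (mod_cast Nat.factorial_pos _) (hr 0 (Nat.zero_le n))
  obtain ⟨ρ₀, hρ₀, hball⟩ := Metric.eventually_nhds_iff.1
    ((derivative^[m] (p 0)).continuous.continuousAt.tendsto.eventually_const_lt hder0)
  obtain ⟨ρ, hρ, hρmin⟩ := exists_between (lt_min hρ₀ (lt_min hδ one_pos))
  have hρ1 : ρ < ρ₀ := hρmin.trans_le (min_le_left _ _)
  have hρδ : ρ < δ := hρmin.trans_le ((min_le_right _ _).trans (min_le_left _ _))
  have hev1 : ∀ᶠ c in 𝓝 (Pi.single 0 1 : ℕ → ℝ), ∀ u ∈ Icc (-ρ) ρ,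
      0 < (derivative^[m] (Y c)).eval u := by
    refine isCompact_Icc.eventually_forall_of_forall_eventually fun u hu ↦ ?_
    refine hcont2.continuousAt.tendsto.eventually_const_lt ?_
    simp only [hYe]
    exact hball (by rw [Real.dist_eq, sub_zero]; exact (abs_le.2 hu).trans_lt hρ1)
  have hev2 : ∀ᶠ c in 𝓝 (Pi.single 0 1 : ℕ → ℝ), ∀ u ∈ Icc ρ 1, 0 < (Y c).eval u := by
    refine isCompact_Icc.eventually_forall_of_forall_eventually fun u hu ↦ ?_
    refine hcont1.continuousAt.tendsto.eventually_const_lt ?_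
    simp only [hYe]
    exact hpos u ⟨hρ.trans_le hu.1, hu.2⟩
  -- Both positivity conditions hold for coefficients near those of p_0, so they are imposed through
  -- the neighbourhood.
  obtain ⟨c, ⟨hcU, hc1, hc2⟩, -, t, ht, hmono, hsign⟩ := exists_alternating_combination
    (fun k u ↦ (p k).eval u) ρ hρ n
    (fun k hk ↦ by simp only [hp k hk]; exact eval_pos_near_zero _ (hr k hk) _)
    (fun k hk j hj ↦ by
      simp only [hp k hk, hp j (by omega)]
      exact eval_isLittleO_of_lt _ _ (hr k hk).ne' (by omega))
    (U ∩ {c | (∀ u ∈ Icc (-ρ) ρ, 0 < (derivative^[m] (Y c)).eval u) ∧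
      ∀ u ∈ Icc ρ 1, 0 < (Y c).eval u}) (inter_mem hU (hev1.and hev2))
  simp only [← hYeval] at hsign
  have hroot : ∀ k < n, ∃ x ∈ Ioo (t (k + 1)) (t k), (Y c).eval x = 0 := by
    intro k hk
    have h1 := hsign k hk.le
    have h2 := hsign (k + 1) hk
    have hle := (hmono k hk).le
    rw [pow_succ] at h2
    rcases neg_one_pow_eq_or ℝ k with h | h <;> rw [h] at h1 h2
    · exact intermediate_value_Ioo hle (Y c).continuousOn ⟨by linarith, by linarith⟩
    · exact intermediate_value_Ioo' hle (Y c).continuousOn ⟨by linarith, by linarith⟩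
  choose! x hx hx0 using hroot
  have hxpos : ∀ k < n, x k ∈ Ioo 0 ρ := fun k hk ↦
    ⟨(ht (k + 1) hk).1.trans (hx k hk).1, (hx k hk).2.trans (ht k hk.le).2⟩
  have htanti : ∀ j k, k ≤ n → j ≤ k → t k ≤ t j := by
    intro j k hk hjk
    induction k, hjk using Nat.le_induction with
    | base => exact le_rfl
    | succ k _ ih => exact (hmono k hk).le.trans (ih (by omega))
  have hxlt : ∀ j k, k < n → j < k → x k < x j := fun j k hk hjk ↦
    ((hx k hk).2.trans_le (htanti (j + 1) k hk.le hjk)).trans (hx j (hjk.trans hk)).1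
  have hxinj : Set.InjOn x (Finset.range n) := by
    intro j hj k hk hjk
    simp only [Finset.coe_range, mem_Iio] at hj hk
    rcases lt_trichotomy j k with h | h | h
    · exact absurd hjk (hxlt j k hk h).ne'
    · exact h
    · exact absurd hjk (hxlt k j hj h).ne
  set A := (Finset.range n).image x with hA
  have memA : ∀ u ∈ A, u ∈ Ioo 0 ρ ∧ (Y c).eval u = 0 := by
    intro u hu
    obtain ⟨k, hk, rfl⟩ := Finset.mem_image.1 hu
    rw [Finset.mem_range] at hk
    exact ⟨hxpos k hk, hx0 k hk⟩
  set B := A.image (fun u ↦ -u) with hB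
  have memB : ∀ u ∈ B, -u ∈ Ioo 0 ρ ∧ (Y c).eval u = 0 := by
    intro u hu
    obtain ⟨v, hv, rfl⟩ := Finset.mem_image.1 hu
    rw [neg_neg, hYodd, (memA v hv).2]
    exact ⟨(memA v hv).1, neg_zero⟩
  have hAcard : A.card = n := by
    rw [hA, Finset.card_image_of_injOn hxinj, Finset.card_range]
  have hBcard : B.card = n := by
    rw [hB, Finset.card_image_of_injective _ neg_injective, hAcard]
  have hAB : Disjoint A B := Finset.disjoint_left.2 fun u hu hu' ↦ by
    have h1 := (memA u hu).1.1
    have h2 := (memB u hu').1.1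
    linarith
  have h0 : (0 : ℝ) ∉ A ∪ B := by
    intro h
    rcases Finset.mem_union.1 h with h | h
    · exact lt_irrefl _ (memA 0 h).1.1
    · simpa using (memB 0 h).1.1
  have hY0 : (Y c).eval 0 = 0 := by
    have := hYodd c 0
    rw [neg_zero] at this
    linarith
  have hscard : (insert 0 (A ∪ B)).card = m := by
    rw [Finset.card_insert_of_notMem h0, Finset.card_union_of_disjoint hAB, hAcard, hBcard, hm]
    ring
  have hsI : ∀ u ∈ insert 0 (A ∪ B), u ∈ Icc (-ρ) ρ ∧ (Y c).eval u = 0 := by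
    intro u hu
    rcases Finset.mem_insert.1 hu with rfl | hu
    · exact ⟨⟨by linarith, hρ.le⟩, hY0⟩
    · rcases Finset.mem_union.1 hu with hu | hu
      · obtain ⟨⟨h1, h2⟩, h3⟩ := memA u hu
        exact ⟨⟨by linarith, h2.le⟩, h3⟩
      · obtain ⟨⟨h1, h2⟩, h3⟩ := memB u hu
        exact ⟨⟨by linarith, by linarith⟩, h3⟩
  have hYne : Y c ≠ 0 := by
    intro h
    have h1 := hc1 0 ⟨by linarith, hρ.le⟩
    rw [h, iterate_derivative_zero, eval_zero] at h1
    exact lt_irrefl _ h1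
  obtain ⟨hall, hsimple⟩ := roots_simple_of_iterate_derivative_ne_zero m (Icc (-ρ) ρ)
    ordConnected_Icc (Y c) hYne (fun u hu ↦ (hc1 u hu).ne') _ hscard hsI
  refine ⟨c, hcU, insert 0 (A ∪ B), hscard, fun u hu ↦ (abs_le.2 (hsI u hu).1).trans_lt hρδ, ?_⟩
  rintro _ rfl
  refine ⟨fun u hu hu0 ↦ ?_, fun u hu ↦ ⟨(hsI u hu).2, hsimple u hu⟩⟩
  change (Y c).eval u = 0 at hu0
  by_cases huI : u ∈ Icc (-ρ) ρ
  · exact hall u huI hu0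
  · rw [mem_Icc, not_and_or, not_le, not_le] at huI
    rcases huI with h | h
    · have h1 := hc2 (-u) ⟨by linarith, by linarith [hu.1]⟩
      rw [hYodd, hu0, neg_zero] at h1
      exact absurd h1 (lt_irrefl _)
    · exact absurd hu0 (hc2 u ⟨h.le, hu.2⟩).ne'

/-! ### Contact functions: order of vanishing at 0 and positivity -/

/-- The functions `f₀ = sin (ν x)`, `f_{j+1} = sin x · f_j' - (2 j + 1) cos x · f_j`, written as a
two-term recurrence. They are the analogues of the spherical Bessel functions for which
`f_j` vanishes to order `2 j + 1` at `0`. -/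
noncomputable def contactFun (ν : ℝ) : ℕ → ℝ → ℝ
  | 0, x => Real.sin (ν * x)
  | 1, x => ν * Real.cos (ν * x) * Real.sin x - Real.cos x * Real.sin (ν * x)
  | j + 2, x => (((j : ℝ) + 1) ^ 2 - ν ^ 2) * Real.sin x ^ 2 * contactFun ν j x -
      (2 * (j : ℝ) + 3) * Real.cos x * contactFun ν (j + 1) x

theorem hasDerivAt_contactFun_zero (ν x : ℝ) :
    HasDerivAt (contactFun ν 0) (ν * Real.cos (ν * x)) x := by
  have h := ((hasDerivAt_id x).const_mul ν).sin
  simp only [id, mul_one] at h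
  rw [mul_comm]
  exact h

theorem hasDerivAt_contactFun_succ (ν : ℝ) (j : ℕ) (x : ℝ) :
    HasDerivAt (contactFun ν (j + 1)) ((((j : ℝ) + 1) ^ 2 - ν ^ 2) * Real.sin x *
      contactFun ν j x) x := by
  -- The induction carries the first-order relation for sin x · f_j' as well. This product suffices,
  -- since f_j' enters the derivative of the recurrence with the factor sin² x.
  suffices h : (∃ d, HasDerivAt (contactFun ν j) d x ∧ Real.sin x * d =
      contactFun ν (j + 1) x + (2 * (j : ℝ) + 1) * Real.cos x * contactFun ν j x) ∧
      HasDerivAt (contactFun ν (j + 1)) ((((j : ℝ) + 1) ^ 2 - ν ^ 2) * Real.sin x *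
      contactFun ν j x) x from h.2
  induction j with
  | zero =>
    have h0 := hasDerivAt_contactFun_zero ν x
    refine ⟨⟨_, h0, ?_⟩, ?_⟩
    · simp only [contactFun]
      push_cast
      ring
    · have h1 : HasDerivAt (fun x ↦ Real.cos (ν * x)) (-Real.sin (ν * x) * (ν * 1)) x :=
        ((hasDerivAt_id x).const_mul ν).cos
      have h2 := ((h1.const_mul ν).mul (Real.hasDerivAt_sin x)).sub
        ((Real.hasDerivAt_cos x).mul h0)
      refine (h2.congr_deriv ?_).congr_of_eventuallyEq (Eventually.of_forall fun y ↦ ?_)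
      · simp only [contactFun]
        push_cast
        ring
      · simp only [contactFun, Pi.sub_apply, Pi.mul_apply]
  | succ j ih =>
    obtain ⟨⟨d, hd, hsd⟩, h1⟩ := ih
    refine ⟨⟨_, h1, ?_⟩, ?_⟩
    · simp only [contactFun]
      push_cast
      ring
    · have h2 := (((Real.hasDerivAt_sin x).pow 2).mul hd).const_mul (((j : ℝ) + 1) ^ 2 - ν ^ 2)
      have h3 := ((Real.hasDerivAt_cos x).mul h1).const_mul (2 * (j : ℝ) + 3)
      refine ((h2.sub h3).congr_deriv ?_).congr_of_eventuallyEq (Eventually.of_forall fun y ↦ ?_)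
      · simp only [Pi.pow_apply]
        push_cast
        linear_combination (((j : ℝ) + 1) ^ 2 - ν ^ 2) * Real.sin x * hsd
      · simp only [contactFun, Pi.sub_apply, Pi.mul_apply, Pi.pow_apply]
        ring

theorem continuous_contactFun (ν : ℝ) (j : ℕ) : Continuous (contactFun ν j) := by
  cases j with
  | zero => exact continuous_iff_continuousAt.2 fun x ↦ (hasDerivAt_contactFun_zero ν x).continuousAt
  | succ j =>
    exact continuous_iff_continuousAt.2 fun x ↦ (hasDerivAt_contactFun_succ ν j x).continuousAt

theorem contactFun_apply_zero (ν : ℝ) (j : ℕ) : contactFun ν j 0 = 0 := by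
  induction j using Nat.twoStepInduction with
  | zero => simp [contactFun]
  | one => simp [contactFun]
  | more j h0 h1 => simp [contactFun, h0, h1]

theorem sq_sub_sq_pos {ν : ℝ} (h0 : 0 < ν) (h1 : ν < 1) (j : ℕ) :
    0 < ((j : ℝ) + 1) ^ 2 - ν ^ 2 := by
  have : (0 : ℝ) ≤ j := Nat.cast_nonneg j
  nlinarith

/-- By L'Hôpital, the limit for j + 1 is ((j + 1)² - ν²)/(2j + 3) times the limit for j, a positive
factor as ν < 1. -/
theorem tendsto_contactFun_div_pow {ν : ℝ} (h0 : 0 < ν) (h1 : ν < 1) (j : ℕ) :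
    ∃ κ > 0, Tendsto (fun x ↦ contactFun ν j x / x ^ (2 * j + 1)) (𝓝[>] 0) (𝓝 κ) := by
  have hsinc : Tendsto (fun x ↦ Real.sin x / x) (𝓝[>] 0) (𝓝 1) := by
    have h := (Real.continuous_sinc.tendsto 0).mono_left (nhdsWithin_le_nhds (s := Ioi 0))
    rw [Real.sinc_zero] at h
    refine h.congr' ?_
    filter_upwards [self_mem_nhdsWithin] with x hx
    exact Real.sinc_of_ne_zero (ne_of_gt hx)
  induction j with
  | zero =>
    refine ⟨ν, h0, ?_⟩
    have h := (hasDerivAt_contactFun_zero ν 0).tendsto_slope_zero_right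
    simp only [contactFun, mul_zero, Real.cos_zero, mul_one, zero_add, Real.sin_zero, sub_zero,
      smul_eq_mul] at h
    refine h.congr fun x ↦ ?_
    simp only [contactFun]
    rw [pow_one, div_eq_inv_mul]
  | succ j ih =>
    obtain ⟨κ, hκ, hlim⟩ := ih
    refine ⟨(((j : ℝ) + 1) ^ 2 - ν ^ 2) / (2 * j + 3) * (1 * κ), ?_, ?_⟩
    · have := sq_sub_sq_pos h0 h1 j
      positivity
    · refine HasDerivAt.lhopital_zero_nhdsGT
        (Eventually.of_forall fun x ↦ hasDerivAt_contactFun_succ ν j x)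
        (Eventually.of_forall fun x ↦ hasDerivAt_pow _ x) ?_ ?_ ?_ ?_
      · filter_upwards [self_mem_nhdsWithin] with x hx
        have : 0 < x := hx
        positivity
      · have := (continuous_contactFun ν (j + 1)).tendsto 0
        rw [contactFun_apply_zero] at this
        exact this.mono_left nhdsWithin_le_nhds
      · have : Tendsto (fun x : ℝ ↦ x ^ (2 * (j + 1) + 1)) (𝓝 0) (𝓝 (0 ^ (2 * (j + 1) + 1))) :=
          (continuous_pow _).tendsto 0
        rw [zero_pow (by omega)] at this
        exact this.mono_left nhdsWithin_le_nhds
      · refine ((hsinc.mul hlim).const_mul _).congr' ?_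
        filter_upwards [self_mem_nhdsWithin] with x hx
        have : 0 < x := hx
        have e : 2 * (j + 1) + 1 - 1 = (2 * j + 1) + 1 := by omega
        rw [e, pow_succ x]
        push_cast
        field_simp
        ring

theorem contactFun_apply_three_pi_div_two_add_two (ν : ℝ) (j : ℕ) :
    contactFun ν (j + 2) (3 * Real.pi / 2) =
      (((j : ℝ) + 1) ^ 2 - ν ^ 2) * contactFun ν j (3 * Real.pi / 2) := by
  have h : 3 * Real.pi / 2 = Real.pi / 2 + Real.pi := by ring
  have hs : Real.sin (3 * Real.pi / 2) = -1 := by rw [h, Real.sin_add_pi, Real.sin_pi_div_two]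
  have hc : Real.cos (3 * Real.pi / 2) = 0 := by rw [h, Real.cos_add_pi, Real.cos_pi_div_two, neg_zero]
  simp only [contactFun]
  rw [hs, hc]
  ring

/-- The derivative of f_{j+1} has the sign of sin, so f_{j+1} rises from 0 on [0, π] and then falls
to a nonnegative value at 3π/2. The bound ν ≤ 2/3 keeps νx below π in the case j = 0. -/
theorem contactFun_pos {ν : ℝ} (h0 : 0 < ν) (h1 : ν ≤ 2 / 3)
    (hend : ∀ j, 0 ≤ contactFun ν j (3 * Real.pi / 2)) (j : ℕ) :
    ∀ x ∈ Ioo 0 (3 * Real.pi / 2), 0 < contactFun ν j x := by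
  have hpi := Real.pi_pos
  induction j with
  | zero =>
    intro x hx
    simp only [contactFun]
    refine Real.sin_pos_of_pos_of_lt_pi (mul_pos h0 hx.1) ?_
    nlinarith [hx.1, hx.2]
  | succ j ih =>
    have ha := sq_sub_sq_pos h0 (h1.trans_lt (by norm_num)) j
    have hcont := continuous_contactFun ν (j + 1)
    have hmono : StrictMonoOn (contactFun ν (j + 1)) (Icc 0 Real.pi) := by
      refine strictMonoOn_of_deriv_pos (convex_Icc _ _) hcont.continuousOn fun x hx ↦ ?_
      rw [interior_Icc] at hx
      rw [(hasDerivAt_contactFun_succ ν j x).deriv]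
      exact mul_pos (mul_pos ha (Real.sin_pos_of_mem_Ioo hx)) (ih x ⟨hx.1, by linarith [hx.2]⟩)
    have hanti : StrictAntiOn (contactFun ν (j + 1)) (Icc Real.pi (3 * Real.pi / 2)) := by
      refine strictAntiOn_of_deriv_neg (convex_Icc _ _) hcont.continuousOn fun x hx ↦ ?_
      rw [interior_Icc] at hx
      rw [(hasDerivAt_contactFun_succ ν j x).deriv]
      have hs : Real.sin x < 0 := by
        have := Real.sin_pos_of_mem_Ioo (x := x - Real.pi) ⟨by linarith [hx.1], by linarith [hx.2]⟩
        rw [Real.sin_sub_pi] at this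
        linarith
      exact mul_neg_of_neg_of_pos (mul_neg_of_pos_of_neg ha hs)
        (ih x ⟨by linarith [hx.1], hx.2⟩)
    intro x hx
    rcases le_total x Real.pi with h | h
    · have := hmono ⟨le_rfl, hpi.le⟩ ⟨hx.1.le, h⟩ hx.1
      rwa [contactFun_apply_zero] at this
    · exact (hend (j + 1)).trans_lt (hanti ⟨h, hx.2.le⟩ ⟨by linarith, le_rfl⟩ hx.2)

/-! ### Contact functions as sine sums with frequencies in steps of 2 -/

/-- The imaginary part of `e^{iμx} q(e^{-2ix})`. -/
noncomputable def sinSum (μ : ℝ) (q : ℝ[X]) (x : ℝ) : ℝ :=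
  (Complex.exp (Complex.I * μ * x) * aeval (Complex.exp (-(2 * Complex.I * x))) q).im

theorem sinSum_sub (μ : ℝ) (q r : ℝ[X]) (x : ℝ) :
    sinSum μ (q - r) x = sinSum μ q x - sinSum μ r x := by
  simp only [sinSum, map_sub, mul_sub, Complex.sub_im]

theorem sinSum_C_mul (μ a : ℝ) (q : ℝ[X]) (x : ℝ) :
    sinSum μ (C a * q) x = a * sinSum μ q x := by
  simp only [sinSum, map_mul, aeval_C, Complex.coe_algebraMap]
  rw [mul_left_comm, Complex.im_ofReal_mul]

theorem sinSum_X_pow (μ : ℝ) (l : ℕ) (x : ℝ) :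
    sinSum μ (X ^ l) x = Real.sin ((μ - 2 * l) * x) := by
  simp only [sinSum, map_pow, aeval_X]
  rw [← Complex.exp_nat_mul, ← Complex.exp_add]
  have : Complex.I * μ * x + l * -(2 * Complex.I * x) = (((μ - 2 * l) * x : ℝ) : ℂ) * Complex.I := by
    push_cast
    ring
  rw [this, Complex.exp_ofReal_mul_I_im]

theorem sinSum_sum {ι : Type*} (μ : ℝ) (s : Finset ι) (q : ι → ℝ[X]) (x : ℝ) :
    sinSum μ (∑ i ∈ s, q i) x = ∑ i ∈ s, sinSum μ (q i) x := by
  simp only [sinSum, map_sum, Finset.mul_sum, Complex.im_sum]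

theorem sinSum_eq_sum (μ : ℝ) (q : ℝ[X]) (n : ℕ) (hq : q.natDegree ≤ n) (x : ℝ) :
    sinSum μ q x = ∑ l ∈ Finset.range (n + 1), q.coeff l * Real.sin ((μ - 2 * l) * x) := by
  conv_lhs => rw [q.as_sum_range_C_mul_X_pow' (Nat.lt_succ_of_le hq)]
  rw [sinSum_sum]
  simp only [sinSum_C_mul, sinSum_X_pow]

/-- This is cos x = e^{ix}(1 + e^{-2ix})/2: the top frequency rises by 1 and the polynomial gains a
factor. -/
theorem cos_mul_sinSum (μ : ℝ) (q : ℝ[X]) (x : ℝ) :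
    Real.cos x * sinSum μ q x = sinSum (μ + 1) (C (1 / 2) * (1 + X) * q) x := by
  simp only [sinSum]
  rw [← Complex.im_ofReal_mul]
  congr 1
  simp only [map_mul, map_add, map_one, aeval_C, aeval_X, Complex.coe_algebraMap]
  push_cast
  have h1 : Complex.exp (Complex.I * (μ + 1) * x) =
      Complex.exp (Complex.I * μ * x) * Complex.exp (x * Complex.I) := by
    rw [← Complex.exp_add]; ring_nf
  have h2 : Complex.exp (-(2 * Complex.I * x)) =
      Complex.exp (-x * Complex.I) * Complex.exp (-x * Complex.I) := by
    rw [← Complex.exp_add]; ring_nf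
  have h3 : Complex.exp (x * Complex.I) * Complex.exp (-x * Complex.I) = 1 := by
    rw [← Complex.exp_add]; simp
  rw [h1, Complex.cos]
  generalize aeval (Complex.exp (-(2 * Complex.I * x))) q = w
  rw [h2]
  linear_combination (-(1 / 2) * Complex.exp (Complex.I * μ * x) * w *
    Complex.exp (-x * Complex.I)) * h3

/-- This is sin² x = -e^{2ix}(1 - e^{-2ix})²/4. -/
theorem sin_sq_mul_sinSum (μ : ℝ) (q : ℝ[X]) (x : ℝ) :
    Real.sin x ^ 2 * sinSum μ q x = sinSum (μ + 2) (C (-(1 / 4)) * (1 - X) ^ 2 * q) x := by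
  simp only [sinSum]
  rw [← Complex.im_ofReal_mul]
  congr 1
  simp only [map_mul, map_sub, map_pow, map_one, aeval_C, aeval_X, Complex.coe_algebraMap]
  push_cast
  have h1 : Complex.exp (Complex.I * (μ + 2) * x) = Complex.exp (Complex.I * μ * x) *
      (Complex.exp (x * Complex.I) * Complex.exp (x * Complex.I)) := by
    rw [← Complex.exp_add, ← Complex.exp_add]; ring_nf
  have h2 : Complex.exp (-(2 * Complex.I * x)) =
      Complex.exp (-x * Complex.I) * Complex.exp (-x * Complex.I) := by
    rw [← Complex.exp_add]; ring_nf
  have h3 : Complex.exp (x * Complex.I) * Complex.exp (-x * Complex.I) = 1 := by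
    rw [← Complex.exp_add]; simp
  rw [h1, Complex.sin]
  generalize aeval (Complex.exp (-(2 * Complex.I * x))) q = w
  rw [h2]
  generalize Complex.exp (-x * Complex.I) = a at *
  generalize Complex.exp (x * Complex.I) = b at *
  generalize Complex.exp (Complex.I * μ * x) = c
  have h4 : ((a - b) * Complex.I / 2) ^ 2 = -(1 / 4) * (a - b) ^ 2 := by
    rw [div_pow, mul_pow, Complex.I_sq]; ring
  rw [h4]
  have h5 : b * b * (1 - a * a) ^ 2 = (b - a) ^ 2 := by
    linear_combination (-2 * (b * a) + (b * a + 1) * a ^ 2) * h3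
  linear_combination (1 / 4 : ℂ) * c * w * h5

theorem cos_pow_mul_sinSum (μ : ℝ) (q : ℝ[X]) (k : ℕ) (x : ℝ) :
    Real.cos x ^ k * sinSum μ q x = sinSum (μ + k) ((C (1 / 2) * (1 + X)) ^ k * q) x := by
  induction k with
  | zero => simp
  | succ k ih =>
    have h1 : μ + ((k + 1 : ℕ) : ℝ) = μ + k + 1 := by push_cast; ring
    rw [h1, pow_succ' (C (1 / 2) * (1 + X) : ℝ[X]), mul_assoc _ _ q, ← cos_mul_sinSum, ← ih]
    ring

/-- The coefficients of `contactFun ν j` as a sum of the functions `sin ((ν + j - 2 l) x)`. -/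
noncomputable def contactPoly (ν : ℝ) : ℕ → ℝ[X]
  | 0 => 1
  | 1 => C ((ν - 1) / 2) - C ((ν + 1) / 2) * X
  | j + 2 => C (((j : ℝ) + 1) ^ 2 - ν ^ 2) * (C (-(1 / 4)) * (1 - X) ^ 2 * contactPoly ν j) -
      C (2 * (j : ℝ) + 3) * (C (1 / 2) * (1 + X) * contactPoly ν (j + 1))

theorem contactFun_eq_sinSum (ν : ℝ) (j : ℕ) (x : ℝ) :
    contactFun ν j x = sinSum (ν + j) (contactPoly ν j) x := by
  induction j using Nat.twoStepInduction with
  | zero =>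
    have := sinSum_X_pow ν 0 x
    simp only [pow_zero, Nat.cast_zero, mul_zero, sub_zero] at this
    simp [contactFun, contactPoly, this]
  | one =>
    rw [sinSum_eq_sum _ _ 1]
    · simp only [contactPoly, contactFun, Finset.sum_range_succ, Finset.sum_range_zero]
      simp only [coeff_sub, coeff_C_mul, coeff_C, coeff_X]
      have h1 : (ν + (1 : ℕ) - 2 * (0 : ℕ)) * x = ν * x + x := by push_cast; ring
      have h2 : (ν + (1 : ℕ) - 2 * (1 : ℕ)) * x = ν * x - x := by push_cast; ring
      rw [h1, h2, Real.sin_add, Real.sin_sub]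
      norm_num
      ring
    · simp only [contactPoly]
      compute_degree
  | more j h0 h1 =>
    simp only [contactFun, contactPoly]
    rw [sinSum_sub, sinSum_C_mul, sinSum_C_mul]
    have e0 : ν + ((j + 2 : ℕ) : ℝ) = ν + j + 2 := by push_cast; ring
    have e1 : ν + ((j + 2 : ℕ) : ℝ) = ν + ((j + 1 : ℕ) : ℝ) + 1 := by push_cast; ring
    nth_rewrite 1 [e0]
    rw [e1, ← sin_sq_mul_sinSum, ← cos_mul_sinSum, ← h0, ← h1]
    ring

theorem natDegree_C_mul_one_add_X_mul_le (q : ℝ[X]) (n : ℕ) (h : q.natDegree ≤ n) :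
    (C (1 / 2) * (1 + X) * q).natDegree ≤ n + 1 := by
  have h1 : (C (1 / 2) * (1 + X) : ℝ[X]).natDegree ≤ 1 := by compute_degree
  exact (natDegree_mul_le_of_le h1 h).trans (by omega)

theorem natDegree_C_mul_one_sub_X_sq_mul_le (q : ℝ[X]) (n : ℕ) (h : q.natDegree ≤ n) :
    (C (-(1 / 4)) * (1 - X) ^ 2 * q).natDegree ≤ n + 2 := by
  have h1 : (C (-(1 / 4)) * (1 - X) ^ 2 : ℝ[X]).natDegree ≤ 2 := by compute_degree
  exact (natDegree_mul_le_of_le h1 h).trans (by omega)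

theorem natDegree_contactPoly_le (ν : ℝ) (j : ℕ) : (contactPoly ν j).natDegree ≤ j := by
  induction j using Nat.twoStepInduction with
  | zero => simp [contactPoly]
  | one =>
    simp only [contactPoly]
    compute_degree
  | more j h0 h1 =>
    simp only [contactPoly]
    refine (natDegree_sub_le _ _).trans (max_le ?_ ?_)
    · exact (natDegree_C_mul_le _ _).trans (natDegree_C_mul_one_sub_X_sq_mul_le _ _ h0)
    · exact (natDegree_C_mul_le _ _).trans (natDegree_C_mul_one_add_X_mul_le _ _ h1)

/-- The two extreme coefficients obey one-term recursions, so they never vanish for 0 < ν < 1. This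
is what later fixes the degrees of y and z. -/
theorem coeff_zero_contactPoly_succ (ν : ℝ) (j : ℕ) :
    (contactPoly ν (j + 1)).coeff 0 = (ν - j - 1) / 2 * (contactPoly ν j).coeff 0 := by
  induction j with
  | zero => simp [contactPoly]
  | succ j ih =>
    have : (contactPoly ν (j + 2)).coeff 0 = (((j : ℝ) + 1) ^ 2 - ν ^ 2) * (-(1 / 4) *
        (contactPoly ν j).coeff 0) - (2 * j + 3) * (1 / 2 * (contactPoly ν (j + 1)).coeff 0) := by
      simp only [coeff_zero_eq_eval_zero, contactPoly]
      simp
    rw [this, ih]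
    push_cast
    ring

theorem coeff_self_contactPoly_succ (ν : ℝ) (j : ℕ) :
    (contactPoly ν (j + 1)).coeff (j + 1) = -(ν + j + 1) / 2 * (contactPoly ν j).coeff j := by
  induction j with
  | zero => simp [contactPoly, coeff_C]; ring
  | succ j ih =>
    have h1 : (C (-(1 / 4)) * (1 - X) ^ 2 * contactPoly ν j).coeff (j + 2) =
        -(1 / 4) * (contactPoly ν j).coeff j := by
      rw [add_comm j 2, coeff_mul_add_eq_of_natDegree_le (by compute_degree)
        (natDegree_contactPoly_le ν j)]
      have : (C (-(1 / 4)) * (1 - X) ^ 2 : ℝ[X]).coeff 2 = -(1 / 4) := by compute_degree!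
      rw [this]
    have h2 : (C (1 / 2) * (1 + X) * contactPoly ν (j + 1)).coeff (j + 2) =
        1 / 2 * (contactPoly ν (j + 1)).coeff (j + 1) := by
      rw [show j + 2 = 1 + (j + 1) by ring, coeff_mul_add_eq_of_natDegree_le (by compute_degree)
        (natDegree_contactPoly_le ν (j + 1))]
      have : (C (1 / 2) * (1 + X) : ℝ[X]).coeff 1 = 1 / 2 := by compute_degree!
      rw [this]
    have : (contactPoly ν (j + 2)).coeff (j + 2) = (((j : ℝ) + 1) ^ 2 - ν ^ 2) * (-(1 / 4) *
        (contactPoly ν j).coeff j) - (2 * j + 3) * (1 / 2 * (contactPoly ν (j + 1)).coeff (j + 1)) := by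
      rw [← h1, ← h2]
      simp only [contactPoly, coeff_sub, coeff_C_mul]
    rw [this, ih]
    push_cast
    ring

theorem coeff_zero_contactPoly_ne_zero {ν : ℝ} (h1 : ν < 1) (j : ℕ) :
    (contactPoly ν j).coeff 0 ≠ 0 := by
  induction j with
  | zero => simp [contactPoly]
  | succ j ih =>
    rw [coeff_zero_contactPoly_succ]
    have : (0 : ℝ) ≤ j := Nat.cast_nonneg j
    exact mul_ne_zero (by linarith) ih

theorem coeff_self_contactPoly_ne_zero {ν : ℝ} (h0 : 0 < ν) (j : ℕ) :
    (contactPoly ν j).coeff j ≠ 0 := by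
  induction j with
  | zero => simp [contactPoly]
  | succ j ih =>
    rw [coeff_self_contactPoly_succ]
    have : (0 : ℝ) ≤ j := Nat.cast_nonneg j
    exact mul_ne_zero (by linarith) ih

/-! ### From sine sums to polynomials in sin θ -/

/-- For even `m`, the odd polynomial `P` with `sin (m θ) = cos θ · P (sin θ)`. -/
noncomputable def sinQuot (m : ℤ) : ℝ[X] :=
  C (-Real.cos (m * (Real.pi / 2))) * Chebyshev.U ℝ (m - 1)

theorem sin_int_mul_pi_div_two {m : ℤ} (hm : Even m) : Real.sin (m * (Real.pi / 2)) = 0 := by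
  obtain ⟨k, rfl⟩ := hm
  have : ((k + k : ℤ) : ℝ) * (Real.pi / 2) = k * Real.pi := by push_cast; ring
  rw [this, Real.sin_int_mul_pi]

theorem cos_int_mul_pi_div_two {m : ℤ} (hm : Odd m) : Real.cos (m * (Real.pi / 2)) = 0 := by
  obtain ⟨k, rfl⟩ := hm
  have : ((2 * k + 1 : ℤ) : ℝ) * (Real.pi / 2) = k * Real.pi + Real.pi / 2 := by push_cast; ring
  rw [this, Real.cos_add_pi_div_two, Real.sin_int_mul_pi, neg_zero]

theorem cos_mul_sinQuot {m : ℤ} (hm : Even m) (θ : ℝ) :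
    Real.cos θ * (sinQuot m).eval (Real.sin θ) = Real.sin (m * θ) := by
  -- At the complementary angle cos becomes sin; for even `m` the factor cos(mπ/2) is ±1 and squares
  -- to 1.
  have h := Chebyshev.U_real_cos (Real.pi / 2 - θ) (m - 1)
  rw [Real.cos_pi_div_two_sub, Real.sin_pi_div_two_sub] at h
  have h1 : (((m - 1 : ℤ) : ℝ) + 1) * (Real.pi / 2 - θ) = m * (Real.pi / 2) - m * θ := by
    push_cast; ring
  rw [h1, Real.sin_sub, sin_int_mul_pi_div_two hm] at h
  have h2 := Real.sin_sq_add_cos_sq (m * (Real.pi / 2))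
  rw [sin_int_mul_pi_div_two hm] at h2
  simp only [sinQuot, eval_mul, eval_C]
  linear_combination (-Real.cos (m * (Real.pi / 2))) * h + Real.sin (m * θ) * h2

/-- The polynomial `P` with `cos θ · P (sin θ) = sinSum (D / 3) q (3 θ)`, for even `D`. -/
noncomputable def sinSumPoly (D n : ℕ) (q : ℝ[X]) : ℝ[X] :=
  ∑ l ∈ Finset.range (n + 1), C (q.coeff l) * sinQuot (D - 6 * l)

theorem cos_mul_sinSumPoly {D : ℕ} (hD : Even D) (n : ℕ) (q : ℝ[X]) (hq : q.natDegree ≤ n) (θ : ℝ) :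
    Real.cos θ * (sinSumPoly D n q).eval (Real.sin θ) = sinSum (D / 3) q (3 * θ) := by
  rw [sinSum_eq_sum _ _ n hq]
  simp only [sinSumPoly, eval_finsetSum, Finset.mul_sum]
  refine Finset.sum_congr rfl fun l _ ↦ ?_
  have he : Even ((D : ℤ) - 6 * l) := by
    refine Even.sub (mod_cast hD) ?_
    exact (even_iff_two_dvd.2 (by norm_num)).mul_right _
  rw [eval_mul, eval_C, mul_left_comm, cos_mul_sinQuot he]
  congr 2
  push_cast
  ring

theorem eval_neg_of_cos_mul_eval_sin (P : ℝ[X])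
    (h : ∀ θ, Real.cos (-θ) * P.eval (Real.sin (-θ)) = -(Real.cos θ * P.eval (Real.sin θ))) (u : ℝ) :
    P.eval (-u) = -P.eval u := by
  suffices hP : P.comp (-X) = -P by
    have := congrArg (fun R ↦ eval u R) hP
    simpa [eval_comp] using this
  refine eq_of_infinite_eval_eq _ _ ((Ioo_infinite (show (-1 : ℝ) < 1 by norm_num)).mono ?_)
  intro v hv
  have h1 := h (Real.arcsin v)
  rw [Real.sin_neg, Real.cos_neg, Real.sin_arcsin hv.1.le hv.2.le] at h1
  have hc : Real.cos (Real.arcsin v) ≠ 0 := by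
    rw [Real.cos_arcsin]
    exact (Real.sqrt_pos.2 (by nlinarith [hv.1, hv.2])).ne'
  simp only [mem_ofPred_eq, eval_comp, eval_neg, eval_X]
  exact mul_left_cancel₀ hc (by rw [h1]; ring)

theorem sinSum_neg_arg (μ : ℝ) (q : ℝ[X]) (x : ℝ) : sinSum μ q (-x) = -sinSum μ q x := by
  rw [sinSum_eq_sum _ _ _ le_rfl, sinSum_eq_sum _ _ _ le_rfl, ← Finset.sum_neg_distrib]
  refine Finset.sum_congr rfl fun l _ ↦ ?_
  rw [mul_neg, Real.sin_neg, mul_neg]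

/-- A finite limit forces p(0) = 0, so a factor X can be cancelled from both sides of the quotient,
`m` times. -/
theorem eq_X_pow_mul_of_tendsto (m : ℕ) (p : ℝ[X]) (κ : ℝ)
    (h : Tendsto (fun u ↦ p.eval u / u ^ m) (𝓝[>] 0) (𝓝 κ)) :
    ∃ r : ℝ[X], p = X ^ m * r ∧ r.eval 0 = κ := by
  induction m generalizing p with
  | zero =>
    refine ⟨p, by simp, ?_⟩
    simp only [pow_zero, div_one] at h
    exact tendsto_nhds_unique ((p.continuous.tendsto 0).mono_left nhdsWithin_le_nhds) h
  | succ m ih =>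
    have h0 : p.eval 0 = 0 := by
      have h1 : Tendsto (fun u : ℝ ↦ u ^ (m + 1)) (𝓝[>] 0) (𝓝 0) := by
        have := ((continuous_pow (M := ℝ) (m + 1)).tendsto 0).mono_left
          (nhdsWithin_le_nhds (s := Ioi 0))
        rwa [zero_pow (Nat.succ_ne_zero m)] at this
      have h2 := h.mul h1
      rw [mul_zero] at h2
      refine tendsto_nhds_unique ((p.continuous.tendsto 0).mono_left nhdsWithin_le_nhds)
        (h2.congr' ?_)
      filter_upwards [self_mem_nhdsWithin] with u hu
      have : u ≠ 0 := ne_of_gt hu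
      field_simp
    obtain ⟨p', rfl⟩ : X ∣ p := X_dvd_iff.2 (by rwa [coeff_zero_eq_eval_zero])
    obtain ⟨r, rfl, hr⟩ := ih p' (h.congr' (by
      filter_upwards [self_mem_nhdsWithin] with u hu
      have : u ≠ 0 := ne_of_gt hu
      rw [eval_mul, eval_X, pow_succ]
      field_simp))
    exact ⟨r, by ring, hr⟩

/-! ### Behaviour at 3π/2, that is, at θ = π/2 -/

theorem contactFun_end_nonneg {ν : ℝ} (h0 : 0 < ν) (h1 : ν < 1)
    (he0 : 0 ≤ contactFun ν 0 (3 * Real.pi / 2)) (he1 : 0 ≤ contactFun ν 1 (3 * Real.pi / 2))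
    (j : ℕ) : 0 ≤ contactFun ν j (3 * Real.pi / 2) := by
  induction j using Nat.twoStepInduction with
  | zero => exact he0
  | one => exact he1
  | more j ih _ =>
    rw [contactFun_apply_three_pi_div_two_add_two]
    exact mul_nonneg (sq_sub_sq_pos h0 h1 j).le ih

theorem contactFun_end_pos {ν : ℝ} (h0 : 0 < ν) (h1 : ν < 1) (i : ℕ)
    (he : 0 < contactFun ν i (3 * Real.pi / 2)) (k : ℕ) :
    0 < contactFun ν (i + 2 * k) (3 * Real.pi / 2) := by
  induction k with
  | zero => exact he
  | succ k ih =>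
    rw [show i + 2 * (k + 1) = i + 2 * k + 2 by ring, contactFun_apply_three_pi_div_two_add_two]
    exact mul_pos (sq_sub_sq_pos h0 h1 _) ih

theorem sin_three_pi_div_two : Real.sin (3 * Real.pi / 2) = -1 := by
  rw [show 3 * Real.pi / 2 = Real.pi / 2 + Real.pi by ring, Real.sin_add_pi, Real.sin_pi_div_two]

theorem cos_three_pi_div_two : Real.cos (3 * Real.pi / 2) = 0 := by
  rw [show 3 * Real.pi / 2 = Real.pi / 2 + Real.pi by ring, Real.cos_add_pi,
    Real.cos_pi_div_two, neg_zero]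

/-- The fractional part ν of D/3 is 2/3 for even n and 1/3 for odd n. At 3π/2, f_0 and f_1 take the
values 0, 2/3 in the first case and 1, 0 in the second. Passing from j to j + 2 multiplies the value
by a positive factor, so f_n vanishes there while f_{n-1} is positive (n ≥ 1), which makes f_n'
nonzero; n = 0 is direct. -/
theorem contactFun_properties (n D : ℕ)
    (h : (Even n ∧ D = 3 * n + 2) ∨ (Odd n ∧ D = 3 * n + 1)) :
    ∃ ν : ℝ, 0 < ν ∧ ν < 1 ∧ (D : ℝ) / 3 = ν + n ∧
      (∀ x ∈ Ioo 0 (3 * Real.pi / 2), 0 < contactFun ν n x) ∧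
      ∃ d ≠ 0, HasDerivAt (contactFun ν n) d (3 * Real.pi / 2) := by
  have hs := sin_three_pi_div_two
  have hc := cos_three_pi_div_two
  have hend : ∀ (ν : ℝ) (j : ℕ), 0 < ν → ν < 1 → 0 < contactFun ν j (3 * Real.pi / 2) →
      ∃ d ≠ 0, HasDerivAt (contactFun ν (j + 1)) d (3 * Real.pi / 2) := by
    intro ν j h0 h1 hj
    refine ⟨_, ?_, hasDerivAt_contactFun_succ ν j _⟩
    rw [hs]
    have := mul_pos (sq_sub_sq_pos h0 h1 j) hj
    linarith
  rcases h with ⟨⟨k, rfl⟩, rfl⟩ | ⟨⟨k, rfl⟩, rfl⟩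
  · have hν : (2 / 3 : ℝ) * (3 * Real.pi / 2) = Real.pi := by ring
    have he0 : contactFun (2 / 3) 0 (3 * Real.pi / 2) = 0 := by
      simp only [contactFun]
      rw [hν, Real.sin_pi]
    have he1 : contactFun (2 / 3) 1 (3 * Real.pi / 2) = 2 / 3 := by
      simp only [contactFun]
      rw [hν, hs, hc, Real.cos_pi]
      ring
    refine ⟨2 / 3, by norm_num, by norm_num, by push_cast; ring,
      contactFun_pos (by norm_num) (by norm_num) (contactFun_end_nonneg (by norm_num) (by norm_num)
        he0.ge (by rw [he1]; norm_num)) _, ?_⟩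
    rcases k with _ | k
    · refine ⟨_, ?_, hasDerivAt_contactFun_zero _ _⟩
      rw [hν, Real.cos_pi]
      norm_num
    · rw [show k + 1 + (k + 1) = 1 + 2 * k + 1 by ring]
      exact hend _ _ (by norm_num) (by norm_num)
        (contactFun_end_pos (by norm_num) (by norm_num) 1 (by rw [he1]; norm_num) k)
  · have hν : (1 / 3 : ℝ) * (3 * Real.pi / 2) = Real.pi / 2 := by ring
    have he0 : contactFun (1 / 3) 0 (3 * Real.pi / 2) = 1 := by
      simp only [contactFun]
      rw [hν, Real.sin_pi_div_two]
    have he1 : contactFun (1 / 3) 1 (3 * Real.pi / 2) = 0 := by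
      simp only [contactFun]
      rw [hν, hc, Real.cos_pi_div_two]
      ring
    refine ⟨1 / 3, by norm_num, by norm_num, by push_cast; ring,
      contactFun_pos (by norm_num) (by norm_num) (contactFun_end_nonneg (by norm_num) (by norm_num)
        (by rw [he0]; norm_num) he1.ge) _, ?_⟩
    have := contactFun_end_pos (ν := 1 / 3) (by norm_num) (by norm_num) 0
      (by rw [he0]; norm_num) k
    rw [zero_add] at this
    exact hend _ _ (by norm_num) (by norm_num) this

/-- If `cos θ · p (sin θ) = cos (3θ)^k · f_j (3θ)`, then `p` vanishes to order exactly `2 j + 1`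
at `0`. -/
theorem eq_X_pow_mul_of_cos_mul_eval_sin {ν : ℝ} (h0 : 0 < ν) (h1 : ν < 1) (j k : ℕ) (p : ℝ[X])
    (hp : ∀ θ, Real.cos θ * p.eval (Real.sin θ) =
      Real.cos (3 * θ) ^ k * contactFun ν j (3 * θ)) :
    ∃ r : ℝ[X], p = X ^ (2 * j + 1) * r ∧ 0 < r.eval 0 := by
  obtain ⟨κ, hκ, hlim⟩ := tendsto_contactFun_div_pow h0 h1 j
  have h3 : Tendsto (fun θ : ℝ ↦ 3 * θ) (𝓝[>] 0) (𝓝[>] 0) := by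
    refine tendsto_nhdsWithin_iff.2 ⟨?_, ?_⟩
    · have : Tendsto (fun θ : ℝ ↦ 3 * θ) (𝓝 0) (𝓝 (3 * 0)) := (by fun_prop : Continuous _).tendsto 0
      rw [mul_zero] at this
      exact this.mono_left nhdsWithin_le_nhds
    · filter_upwards [self_mem_nhdsWithin] with θ hθ
      have : 0 < θ := hθ
      exact mul_pos three_pos this
  have hsinc : Tendsto (fun θ ↦ (Real.cos (3 * θ) ^ k / Real.cos θ) * (3 / Real.sinc θ) ^ (2 * j + 1))
      (𝓝[>] 0) (𝓝 ((Real.cos (3 * 0) ^ k / Real.cos 0) * (3 / Real.sinc 0) ^ (2 * j + 1))) := by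
    refine Tendsto.mono_left (ContinuousAt.tendsto ?_) nhdsWithin_le_nhds
    have hs := Real.continuous_sinc.continuousAt (x := 0)
    have hs0 : Real.sinc 0 ≠ 0 := by simp
    have hc0 : Real.cos 0 ≠ 0 := by simp
    refine ContinuousAt.mul (ContinuousAt.div (by fun_prop) (by fun_prop) hc0)
      (ContinuousAt.pow (continuousAt_const.div hs hs0) _)
  have hθ : Tendsto (fun θ ↦ p.eval (Real.sin θ) / Real.sin θ ^ (2 * j + 1)) (𝓝[>] 0)
      (𝓝 (3 ^ (2 * j + 1) * κ)) := by
    have := hsinc.mul (hlim.comp h3)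
    simp only [mul_zero, Real.cos_zero, one_pow, div_one, Real.sinc_zero, one_mul] at this
    refine this.congr' ?_
    filter_upwards [Ioo_mem_nhdsGT (show (0 : ℝ) < 1 by norm_num)] with θ hθ
    have hθ0 : 0 < θ := hθ.1
    have hc : 0 < Real.cos θ := Real.cos_pos_of_mem_Ioo
      ⟨by linarith [Real.pi_pos], by linarith [hθ.2, Real.pi_gt_three]⟩
    have hs : 0 < Real.sin θ := Real.sin_pos_of_pos_of_lt_pi hθ0
      (by linarith [hθ.2, Real.pi_gt_three])
    have hpe : p.eval (Real.sin θ) = Real.cos (3 * θ) ^ k * contactFun ν j (3 * θ) / Real.cos θ := by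
      rw [← hp]
      field_simp
    simp only [Function.comp]
    rw [hpe, Real.sinc_of_ne_zero hθ0.ne', mul_pow, div_div_eq_mul_div, div_pow, mul_pow]
    field_simp
  have harcsin : Tendsto Real.arcsin (𝓝[>] 0) (𝓝[>] 0) := by
    refine tendsto_nhdsWithin_iff.2 ⟨?_, ?_⟩
    · have := Real.continuous_arcsin.tendsto 0
      rw [Real.arcsin_zero] at this
      exact this.mono_left nhdsWithin_le_nhds
    · filter_upwards [self_mem_nhdsWithin] with u hu
      exact Real.arcsin_pos.2 hu
  have hu : Tendsto (fun u ↦ p.eval u / u ^ (2 * j + 1)) (𝓝[>] 0) (𝓝 (3 ^ (2 * j + 1) * κ)) := by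
    refine (hθ.comp harcsin).congr' ?_
    filter_upwards [Ioo_mem_nhdsGT (show (0 : ℝ) < 1 by norm_num)] with u hu
    simp only [Function.comp]
    rw [Real.sin_arcsin (by linarith [hu.1]) hu.2.le]
  obtain ⟨r, hr, hr0⟩ := eq_X_pow_mul_of_tendsto _ p _ hu
  exact ⟨r, hr, by rw [hr0]; positivity⟩

/-- On (0, 1) one divides by cos θ. At u = 1 this factor vanishes, and p(1) is read off the
derivative at π/2: -p(1) = 3d. -/
theorem eval_pos_of_cos_mul_eval_sin (p : ℝ[X]) (f : ℝ → ℝ)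
    (hp : ∀ θ, Real.cos θ * p.eval (Real.sin θ) = f (3 * θ))
    (hpos : ∀ x ∈ Ioo 0 (3 * Real.pi / 2), 0 < f x) (d : ℝ) (hd : d ≠ 0)
    (hder : HasDerivAt f d (3 * Real.pi / 2)) : ∀ u ∈ Ioc (0 : ℝ) 1, 0 < p.eval u := by
  have hIoo : ∀ u ∈ Ioo (0 : ℝ) 1, 0 < p.eval u := by
    intro u hu
    have h1 := hp (Real.arcsin u)
    rw [Real.sin_arcsin (by linarith [hu.1]) hu.2.le] at h1
    have h2 := Real.arcsin_pos.2 hu.1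
    have h3 := Real.arcsin_lt_pi_div_two.2 hu.2
    have h4 := hpos (3 * Real.arcsin u) ⟨by linarith, by linarith⟩
    rw [← h1] at h4
    exact pos_of_mul_pos_right h4 (Real.cos_arcsin_nonneg u)
  intro u hu
  rcases hu.2.lt_or_eq with h | rfl
  · exact hIoo u ⟨hu.1, h⟩
  · have hnn : 0 ≤ p.eval 1 := by
      refine ge_of_tendsto ((p.continuous.tendsto 1).mono_left (nhdsWithin_le_nhds (s := Iio 1))) ?_
      filter_upwards [Ioo_mem_nhdsLT (show (0 : ℝ) < 1 by norm_num)] with u hu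
      exact (hIoo u hu).le
    refine hnn.lt_of_ne fun h10 ↦ hd ?_
    have e1 : 3 * Real.pi / 2 = 3 * (Real.pi / 2) := by ring
    rw [e1] at hder
    have h1 : HasDerivAt (fun θ ↦ f (3 * θ)) (d * (3 * 1)) (Real.pi / 2) :=
      HasDerivAt.comp (Real.pi / 2) hder ((hasDerivAt_id _).const_mul 3)
    have h2 := (Real.hasDerivAt_cos (Real.pi / 2)).mul
      (HasDerivAt.comp (Real.pi / 2) (p.hasDerivAt (Real.sin (Real.pi / 2)))
        (Real.hasDerivAt_sin (Real.pi / 2)))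
    have h3 : HasDerivAt (fun θ ↦ f (3 * θ)) _ (Real.pi / 2) :=
      h2.congr_of_eventuallyEq (Eventually.of_forall fun θ ↦ (hp θ).symm)
    have h4 := h1.unique h3
    rw [Real.cos_pi_div_two, Function.comp, Real.sin_pi_div_two, ← h10] at h4
    linarith

/-! ### The sine sum with N simple zeros -/

/-- There is a trigonometric sum with the prescribed frequencies whose zeros in `(-π/2, π/2)` are
`2 n + 1` simple zeros in `(-π/6, π/6)`. -/
theorem exists_sinSum_with_simple_zeros (n D : ℕ)
    (h : (Even n ∧ D = 3 * n + 2) ∨ (Odd n ∧ D = 3 * n + 1)) :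
    ∃ (q : ℕ → ℝ) (Y : ℝ[X]) (s : Finset ℝ), q 0 ≠ 0 ∧ q n ≠ 0 ∧
      (∀ θ, Real.cos θ * Y.eval (Real.sin θ) =
        ∑ l ∈ Finset.range (n + 1), q l * Real.sin (((D : ℝ) - 6 * l) * θ)) ∧
      s.card = 2 * n + 1 ∧ (∀ u ∈ s, |u| < 1 / 2) ∧
      (∀ u ∈ Icc (-1 : ℝ) 1, Y.eval u = 0 → u ∈ s) ∧
      ∀ u ∈ s, Y.eval u = 0 ∧ Y.derivative.eval u ≠ 0 := by
  obtain ⟨ν, h0, h1, hD3, hpos, d, hd, hder⟩ := contactFun_properties n D h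
  have hDe : Even D := by
    rcases h with ⟨⟨k, rfl⟩, rfl⟩ | ⟨⟨k, rfl⟩, rfl⟩
    · exact ⟨3 * k + 1, by ring⟩
    · exact ⟨3 * k + 2, by ring⟩
  -- `Q k` encodes cos^k · f_{n-k}; each factor cos raises the top frequency by 1, so all share D/3
  -- = ν + n.
  let Q : ℕ → ℝ[X] := fun k ↦ (C (1 / 2) * (1 + X)) ^ k * contactPoly ν (n - k)
  have hQdeg : ∀ k ≤ n, (Q k).natDegree ≤ n := by
    intro k hk
    have h2 : (C (1 / 2) * (1 + X) : ℝ[X]).natDegree ≤ 1 := by compute_degree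
    refine (natDegree_mul_le_of_le (natDegree_pow_le_of_le k h2)
      (natDegree_contactPoly_le ν (n - k))).trans (by omega)
  have hQ : ∀ k ≤ n, ∀ x, sinSum (D / 3) (Q k) x = Real.cos x ^ k * contactFun ν (n - k) x := by
    intro k hk x
    have : (D : ℝ) / 3 = ν + ((n - k : ℕ) : ℝ) + k := by
      rw [hD3, Nat.cast_sub hk]
      ring
    rw [this, ← cos_pow_mul_sinSum, contactFun_eq_sinSum]
  have hp : ∀ k ≤ n, ∀ θ, Real.cos θ * (sinSumPoly D n (Q k)).eval (Real.sin θ) =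
      Real.cos (3 * θ) ^ k * contactFun ν (n - k) (3 * θ) := fun k hk θ ↦ by
    rw [cos_mul_sinSumPoly hDe n _ (hQdeg k hk), hQ k hk]
  have hr : ∀ k, ∃ r : ℝ[X], k ≤ n →
      sinSumPoly D n (Q k) = X ^ (2 * (n - k) + 1) * r ∧ 0 < r.eval 0 := by
    intro k
    by_cases hk : k ≤ n
    · obtain ⟨r, hr⟩ := eq_X_pow_mul_of_cos_mul_eval_sin h0 h1 (n - k) k _ (hp k hk)
      exact ⟨r, fun _ ↦ hr⟩
    · exact ⟨0, fun h ↦ absurd h hk⟩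
  choose r hr using hr
  have hodd : ∀ k ≤ n, ∀ u, (sinSumPoly D n (Q k)).eval (-u) = -(sinSumPoly D n (Q k)).eval u := by
    intro k hk
    refine eval_neg_of_cos_mul_eval_sin _ fun θ ↦ ?_
    rw [cos_mul_sinSumPoly hDe n _ (hQdeg k hk), cos_mul_sinSumPoly hDe n _ (hQdeg k hk), mul_neg,
      sinSum_neg_arg]
  have hpos0 : ∀ u ∈ Ioc (0 : ℝ) 1, 0 < (sinSumPoly D n (Q 0)).eval u :=
    eval_pos_of_cos_mul_eval_sin _ (contactFun ν n)
      (fun θ ↦ by rw [hp 0 (Nat.zero_le n), pow_zero, one_mul, Nat.sub_zero]) hpos d hd hder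
  let q : (ℕ → ℝ) → ℕ → ℝ := fun c l ↦ ∑ k ∈ Finset.range (n + 1), c k * (Q k).coeff l
  have hqcont : ∀ l, Continuous fun c ↦ q c l := fun l ↦
    continuous_finsetSum _ fun k _ ↦ (continuous_apply k).mul continuous_const
  have hqe : ∀ l, q (Pi.single 0 1) l = (contactPoly ν n).coeff l := by
    intro l
    simp only [q]
    rw [Finset.sum_range_succ', Finset.sum_eq_zero]
    · simp [Q]
    · intro k _
      simp
  have hU : {c | q c 0 ≠ 0 ∧ q c n ≠ 0} ∈ 𝓝 (Pi.single 0 1 : ℕ → ℝ) := by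
    refine Filter.Eventually.and ?_ ?_
    · refine (hqcont 0).continuousAt.eventually_ne ?_
      rw [hqe]
      exact coeff_zero_contactPoly_ne_zero h1 n
    · refine (hqcont n).continuousAt.eventually_ne ?_
      rw [hqe]
      exact coeff_self_contactPoly_ne_zero h0 n
  obtain ⟨c, ⟨hc0, hcn⟩, s, hs, hsδ, hsY⟩ := exists_combination_with_simple_roots n
    (fun k ↦ sinSumPoly D n (Q k)) r (fun k hk ↦ (hr k hk).1) (fun k hk ↦ (hr k hk).2) hodd hpos0
    (1 / 2) (by norm_num) _ hU
  obtain ⟨hY1, hY2⟩ := hsY _ rfl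
  refine ⟨q c, _, s, hc0, hcn, fun θ ↦ ?_, hs, hsδ, hY1, hY2⟩
  simp only [eval_finsetSum, Finset.mul_sum, eval_mul, eval_C, q, Finset.sum_mul]
  rw [Finset.sum_comm]
  refine Finset.sum_congr rfl fun k hk ↦ ?_
  have hk' : k ≤ n := Nat.lt_succ_iff.1 (Finset.mem_range.1 hk)
  rw [mul_left_comm, cos_mul_sinSumPoly hDe n _ (hQdeg k hk'), sinSum_eq_sum _ _ n (hQdeg k hk'),
    Finset.mul_sum]
  refine Finset.sum_congr rfl fun l _ ↦ ?_
  rw [mul_assoc]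
  congr 3
  ring

/-! ### Lifting sine and cosine sums to y and z -/

theorem natDegree_sum_chebyshev {ι : Type*} [DecidableEq ι] (s : Finset ι) (m : ι → ℤ) (a : ι → ℝ)
    (i : ι) (hi : i ∈ s) (hai : a i ≠ 0)
    (hlt : ∀ j ∈ s, j ≠ i → (m j).natAbs < (m i).natAbs) :
    (∑ j ∈ s, C (a j) * Chebyshev.T ℝ (m j)).natDegree = (m i).natAbs := by
  have hmain : (C (a i) * Chebyshev.T ℝ (m i)).natDegree = (m i).natAbs := by
    rw [natDegree_C_mul hai, Chebyshev.natDegree_T]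
  rw [← Finset.add_sum_erase s _ hi]
  rcases (s.erase i).eq_empty_or_nonempty with h | ⟨k, hk⟩
  · rw [h, Finset.sum_empty, add_zero, hmain]
  · have h0 : 0 < (m i).natAbs :=
      (Nat.zero_le _).trans_lt (hlt k (Finset.mem_of_mem_erase hk) (Finset.ne_of_mem_erase hk))
    rw [natDegree_add_eq_left_of_natDegree_lt, hmain]
    rw [hmain]
    refine (natDegree_sum_le_of_forall_le (n := (m i).natAbs - 1) _ _ fun j hj ↦ ?_).trans_lt
      (by omega)
    have := hlt j (Finset.mem_of_mem_erase hj) (Finset.ne_of_mem_erase hj)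
    refine (natDegree_C_mul_le _ _).trans ?_
    rw [Chebyshev.natDegree_T]
    omega

theorem eval_T_sin (m : ℤ) (α : ℝ) : (Chebyshev.T ℝ m).eval (Real.sin α) =
    Real.cos (m * (Real.pi / 2)) * Real.cos (m * α) +
      Real.sin (m * (Real.pi / 2)) * Real.sin (m * α) := by
  rw [← Real.cos_pi_div_two_sub, Chebyshev.T_real_cos, mul_sub, Real.cos_sub]

theorem sin_int_mul_pi_div_three_ne_zero {m : ℤ} (hm : ¬ 3 ∣ m) :
    Real.sin (m * (Real.pi / 3)) ≠ 0 := by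
  rw [Real.sin_ne_zero_iff]
  intro k hk
  have hpi := Real.pi_ne_zero
  have h1 : (m : ℝ) = 3 * k := by
    field_simp at hk
    linarith
  exact hm ⟨k, by exact_mod_cast h1⟩

/-- For even m, T_m(sin α) = cos(mπ/2) cos(mα), and its difference at θ ± π/3 is -2 cos(mπ/2)
sin(mπ/3) sin(mθ). The constant is nonzero as 3 ∤ m, so dividing by it prescribes any coefficient.
-/
theorem exists_polynomial_sum_sin {ι : Type*} [DecidableEq ι] (s : Finset ι) (m : ι → ℤ)
    (a : ι → ℝ) (hme : ∀ j ∈ s, Even (m j)) (hm3 : ∀ j ∈ s, ¬ 3 ∣ m j) (i : ι) (hi : i ∈ s)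
    (hai : a i ≠ 0) (hlt : ∀ j ∈ s, j ≠ i → (m j).natAbs < (m i).natAbs) :
    ∃ y : ℝ[X], y.natDegree = (m i).natAbs ∧ ∀ θ, y.eval (Real.sin (θ + Real.pi / 3)) -
      y.eval (Real.sin (θ - Real.pi / 3)) = ∑ j ∈ s, a j * Real.sin (m j * θ) := by
  have hne : ∀ j ∈ s, -2 * Real.cos (m j * (Real.pi / 2)) * Real.sin (m j * (Real.pi / 3)) ≠ 0 := by
    intro j hj
    refine mul_ne_zero (mul_ne_zero (by norm_num) fun h ↦ ?_)
      (sin_int_mul_pi_div_three_ne_zero (hm3 j hj))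
    have := Real.sin_sq_add_cos_sq (m j * (Real.pi / 2))
    rw [h, sin_int_mul_pi_div_two (hme j hj)] at this
    norm_num at this
  refine ⟨_, natDegree_sum_chebyshev s m
    (fun j ↦ a j / (-2 * Real.cos (m j * (Real.pi / 2)) * Real.sin (m j * (Real.pi / 3)))) i hi
    (div_ne_zero hai (hne i hi)) hlt, fun θ ↦ ?_⟩
  rw [eval_finsetSum, eval_finsetSum, ← Finset.sum_sub_distrib]
  refine Finset.sum_congr rfl fun j hj ↦ ?_
  rw [eval_mul, eval_mul, eval_C, eval_C, ← mul_sub, eval_T_sin, eval_T_sin,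
    sin_int_mul_pi_div_two (hme j hj), mul_add _ θ, mul_sub _ θ, Real.cos_add, Real.cos_sub, div_mul_eq_mul_div,
    div_eq_iff (hne j hj)]
  ring

theorem exists_polynomial_sum_cos {ι : Type*} [DecidableEq ι] (s : Finset ι) (m : ι → ℤ)
    (a : ι → ℝ) (hmo : ∀ j ∈ s, Odd (m j)) (hm3 : ∀ j ∈ s, ¬ 3 ∣ m j) (i : ι) (hi : i ∈ s)
    (hai : a i ≠ 0) (hlt : ∀ j ∈ s, j ≠ i → (m j).natAbs < (m i).natAbs) :
    ∃ z : ℝ[X], z.natDegree = (m i).natAbs ∧ ∀ θ, z.eval (Real.sin (θ + Real.pi / 3)) -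
      z.eval (Real.sin (θ - Real.pi / 3)) = ∑ j ∈ s, a j * Real.cos (m j * θ) := by
  have hne : ∀ j ∈ s, 2 * Real.sin (m j * (Real.pi / 2)) * Real.sin (m j * (Real.pi / 3)) ≠ 0 := by
    intro j hj
    refine mul_ne_zero (mul_ne_zero (by norm_num) fun h ↦ ?_)
      (sin_int_mul_pi_div_three_ne_zero (hm3 j hj))
    have := Real.sin_sq_add_cos_sq (m j * (Real.pi / 2))
    rw [h, cos_int_mul_pi_div_two (hmo j hj)] at this
    norm_num at this
  refine ⟨_, natDegree_sum_chebyshev s m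
    (fun j ↦ a j / (2 * Real.sin (m j * (Real.pi / 2)) * Real.sin (m j * (Real.pi / 3)))) i hi
    (div_ne_zero hai (hne i hi)) hlt, fun θ ↦ ?_⟩
  rw [eval_finsetSum, eval_finsetSum, ← Finset.sum_sub_distrib]
  refine Finset.sum_congr rfl fun j hj ↦ ?_
  rw [eval_mul, eval_mul, eval_C, eval_C, ← mul_sub, eval_T_sin, eval_T_sin,
    cos_int_mul_pi_div_two (hmo j hj), mul_add _ θ, mul_sub _ θ, Real.sin_add, Real.sin_sub, div_mul_eq_mul_div,
    div_eq_iff (hne j hj)]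
  ring

/-- Eliminating the top frequency between `cos 3θ · f'` and `sin 3θ · f`. -/
theorem cos_mul_sum_add_sin_mul_sum (n : ℕ) (D : ℝ) (q : ℕ → ℝ) (θ : ℝ) :
    Real.cos (3 * θ) *
        (∑ l ∈ Finset.range (n + 1), q l * ((D - 6 * l) * Real.cos ((D - 6 * l) * θ))) +
      D * Real.sin (3 * θ) * ∑ l ∈ Finset.range (n + 1), q l * Real.sin ((D - 6 * l) * θ) =
    ∑ l ∈ Finset.range (n + 1), (q l * (D - 3 * l) - if l < n then 3 * (l + 1) * q (l + 1) else 0) *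
      Real.cos ((D - 3 - 6 * l) * θ) := by
  have h1 : ∀ l : ℕ, Real.cos (3 * θ) * (q l * ((D - 6 * l) * Real.cos ((D - 6 * l) * θ))) +
      D * Real.sin (3 * θ) * (q l * Real.sin ((D - 6 * l) * θ)) =
      q l * (D - 3 * l) * Real.cos ((D - 3 - 6 * l) * θ) -
        3 * l * q l * Real.cos ((D + 3 - 6 * l) * θ) := by
    intro l
    have e1 : (D - 3 - 6 * l) * θ = (D - 6 * l) * θ - 3 * θ := by ring
    have e2 : (D + 3 - 6 * l) * θ = (D - 6 * l) * θ + 3 * θ := by ring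
    rw [e1, e2, Real.cos_sub, Real.cos_add]
    ring
  have h2 : ∑ l ∈ Finset.range (n + 1), 3 * (l : ℝ) * q l * Real.cos ((D + 3 - 6 * l) * θ) =
      ∑ l ∈ Finset.range (n + 1), (if l < n then 3 * ((l : ℝ) + 1) * q (l + 1) else 0) *
        Real.cos ((D - 3 - 6 * l) * θ) := by
    -- The term l = 0, of frequency D + 3, carries the factor l and drops out; the others are
    -- shifted by one index.
    rw [Finset.sum_range_succ', Finset.sum_range_succ, if_neg (lt_irrefl n)]
    simp only [Nat.cast_zero, mul_zero, zero_mul]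
    congr 1
    refine Finset.sum_congr rfl fun l hl ↦ ?_
    rw [if_pos (Finset.mem_range.1 hl)]
    push_cast
    congr 2
    ring
  rw [Finset.mul_sum, Finset.mul_sum, ← Finset.sum_add_distrib, Finset.sum_congr rfl fun l _ ↦ h1 l,
    Finset.sum_sub_distrib, h2, ← Finset.sum_sub_distrib]
  exact Finset.sum_congr rfl fun l _ ↦ (sub_mul _ _ _).symm

/-! ### Alternating signs at consecutive simple zeros -/

/-- Write p = (X - a)(X - b)g: g has constant sign on [a, b], and the derivatives are -(b - a)g(a)
and (b - a)g(b). -/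
theorem derivative_eval_mul_neg_of_consecutive_roots (p : ℝ[X]) {a b : ℝ} (hab : a < b)
    (ha : p.eval a = 0) (hb : p.eval b = 0) (ha' : p.derivative.eval a ≠ 0)
    (hb' : p.derivative.eval b ≠ 0) (hno : ∀ u ∈ Ioo a b, p.eval u ≠ 0) :
    p.derivative.eval a * p.derivative.eval b < 0 := by
  obtain ⟨p₁, rfl⟩ := dvd_iff_isRoot.2 (show IsRoot p a from ha)
  have hb1 : p₁.eval b = 0 := by
    rw [eval_mul] at hb
    refine (mul_eq_zero.1 hb).resolve_left ?_
    simpa using sub_ne_zero.2 hab.ne'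
  obtain ⟨g, rfl⟩ := dvd_iff_isRoot.2 (show IsRoot p₁ b from hb1)
  have h1 : ((X - C a) * ((X - C b) * g)).derivative.eval a = -((b - a) * g.eval a) := by
    simp [derivative_mul]
    ring
  have h2 : ((X - C a) * ((X - C b) * g)).derivative.eval b = (b - a) * g.eval b := by
    simp [derivative_mul]
  rw [h1] at ha'
  rw [h2] at hb'
  rw [h1, h2]
  have hpos : 0 < b - a := sub_pos.2 hab
  have hga : g.eval a ≠ 0 := fun h ↦ ha' (by rw [h]; ring)
  have hgb : g.eval b ≠ 0 := fun h ↦ hb' (by rw [h]; ring)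
  have hg : 0 < g.eval a * g.eval b := by
    by_contra hneg
    have hno' : ∀ u ∈ Ioo a b, g.eval u ≠ 0 := fun u hu h ↦ hno u hu (by simp [h])
    rcases lt_or_gt_of_ne hga with h | h <;> rcases lt_or_gt_of_ne hgb with h' | h'
    · exact hneg (mul_pos_of_neg_of_neg h h')
    · obtain ⟨u, hu, hu0⟩ := intermediate_value_Ioo hab.le g.continuousOn ⟨h, h'⟩
      exact hno' u hu hu0
    · obtain ⟨u, hu, hu0⟩ := intermediate_value_Ioo' hab.le g.continuousOn ⟨h', h⟩
      exact hno' u hu hu0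
    · exact hneg (mul_pos h h')
  have h3 : 0 < (b - a) ^ 2 * (g.eval a * g.eval b) := by positivity
  linarith

theorem exists_sign_alternating {N : ℕ} (w : Fin N → ℝ) (h0 : ∀ i, w i ≠ 0)
    (h : ∀ (i : ℕ) (hi : i + 1 < N), w ⟨i, by omega⟩ * w ⟨i + 1, hi⟩ < 0) :
    ∃ σ : ℝ, σ ≠ 0 ∧ ∀ i : Fin N, 0 < σ * (-1) ^ (i : ℕ) * w i := by
  rcases Nat.eq_zero_or_pos N with rfl | hN
  · exact ⟨1, one_ne_zero, fun i ↦ i.elim0⟩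
  · refine ⟨w ⟨0, hN⟩, h0 _, fun ⟨i, hi⟩ ↦ ?_⟩
    induction i with
    | zero => simpa using mul_self_pos.2 (h0 ⟨0, hN⟩)
    | succ i ih =>
      have h1 := ih (by omega)
      have h2 := h i hi
      have h3 := mul_neg_of_pos_of_neg h1 h2
      simp only at h1 h3 ⊢
      rw [pow_succ]
      have h4 : 0 < w ⟨i, by omega⟩ ^ 2 := by have := h0 ⟨i, by omega⟩; positivity
      refine pos_of_mul_pos_right (a := w ⟨i, by omega⟩ ^ 2) ?_ h4.le
      linarith

/-- Polynomials `y`, `z` of the required degrees, such that the zeros in `(-π/2, π/2)` of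
`f θ = y (sin (θ + π/3)) - y (sin (θ - π/3))` are `2 n + 1` simple zeros in `(-π/6, π/6)`, where the
same difference for `z` has the sign of `f'`. -/
theorem exists_height_polynomials (n D : ℕ)
    (h : (Even n ∧ D = 3 * n + 2) ∨ (Odd n ∧ D = 3 * n + 1)) :
    ∃ (y z Y : ℝ[X]) (s : Finset ℝ), y.natDegree = D ∧ z.natDegree = 6 * n + 3 - D ∧
      s.card = 2 * n + 1 ∧ (∀ u ∈ s, |u| < 1 / 2) ∧
      (∀ u ∈ Icc (-1 : ℝ) 1, Y.eval u = 0 → u ∈ s) ∧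
      (∀ u ∈ s, Y.eval u = 0 ∧ Y.derivative.eval u ≠ 0) ∧
      (∀ θ, y.eval (Real.sin (θ + Real.pi / 3)) - y.eval (Real.sin (θ - Real.pi / 3)) =
        Real.cos θ * Y.eval (Real.sin θ)) ∧
      ∀ θ, Y.eval (Real.sin θ) = 0 →
        z.eval (Real.sin (θ + Real.pi / 3)) - z.eval (Real.sin (θ - Real.pi / 3)) =
          Real.cos (3 * θ) * (Real.cos θ ^ 2 * Y.derivative.eval (Real.sin θ)) := by
  obtain ⟨q, Y, s, hq0, hqn, hY, hs, hsδ, hY1, hY2⟩ := exists_sinSum_with_simple_zeros n D h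
  have hDe : Even D := by
    rcases h with ⟨⟨k, rfl⟩, rfl⟩ | ⟨⟨k, rfl⟩, rfl⟩
    · exact ⟨3 * k + 1, by ring⟩
    · exact ⟨3 * k + 2, by ring⟩
  obtain ⟨k, hk⟩ := hDe
  obtain ⟨y, hy, hyθ⟩ := exists_polynomial_sum_sin (Finset.range (n + 1))
    (fun l ↦ (D : ℤ) - 6 * l) q (fun l _ ↦ ⟨k - 3 * l, by subst hk; push_cast; ring⟩)
    (fun l _ ↦ by omega) 0 (by simp) hq0 (fun l hl hl0 ↦ by
      rw [Finset.mem_range] at hl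
      omega)
  -- Since D > 3n, the largest of the |D - 3 - 6l| is at l = n, where the coefficient is q_n(D - 3n)
  -- ≠ 0; for y it was at l = 0.
  obtain ⟨z, hz, hzθ⟩ := exists_polynomial_sum_cos (Finset.range (n + 1))
    (fun l ↦ (D : ℤ) - 3 - 6 * l)
    (fun l ↦ q l * ((D : ℝ) - 3 * l) - if l < n then 3 * ((l : ℝ) + 1) * q (l + 1) else 0)
    (fun l _ ↦ ⟨k - 3 * l - 2, by subst hk; push_cast; ring⟩)
    (fun l _ ↦ by omega) n (by simp) (by
      rw [if_neg (lt_irrefl n), sub_zero]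
      refine mul_ne_zero hqn ?_
      have : 3 * n < D := by omega
      have : (3 : ℝ) * n < D := by exact_mod_cast this
      exact (sub_pos.2 this).ne')
    (fun l hl hl0 ↦ by
      rw [Finset.mem_range] at hl
      omega)
  have hyY : ∀ θ, y.eval (Real.sin (θ + Real.pi / 3)) - y.eval (Real.sin (θ - Real.pi / 3)) =
      Real.cos θ * Y.eval (Real.sin θ) := by
    intro θ
    rw [hyθ, hY]
    push_cast
    rfl
  refine ⟨y, z, Y, s, by omega, by omega, hs, hsδ, hY1, hY2, hyY, fun θ hθ ↦ ?_⟩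
  have hder : HasDerivAt (fun θ ↦ ∑ l ∈ Finset.range (n + 1), q l * Real.sin (((D : ℝ) - 6 * l) * θ))
      (∑ l ∈ Finset.range (n + 1), q l * (((D : ℝ) - 6 * l) * Real.cos (((D : ℝ) - 6 * l) * θ)))
      θ := by
    refine HasDerivAt.fun_sum fun l _ ↦ HasDerivAt.const_mul _ ?_
    have := ((hasDerivAt_id' θ).const_mul ((D : ℝ) - 6 * l)).sin
    rwa [mul_one, mul_comm (Real.cos _)] at this
  have hder' := (Real.hasDerivAt_cos θ).mul
    (HasDerivAt.comp θ (Y.hasDerivAt (Real.sin θ)) (Real.hasDerivAt_sin θ))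
  have hder'' : HasDerivAt
      (fun θ ↦ ∑ l ∈ Finset.range (n + 1), q l * Real.sin (((D : ℝ) - 6 * l) * θ)) _ θ :=
    hder'.congr_of_eventuallyEq (Eventually.of_forall fun θ ↦ (hY θ).symm)
  have huniq := hder.unique hder''
  rw [Function.comp, hθ] at huniq
  have hcomb := cos_mul_sum_add_sin_mul_sum n D q θ
  rw [huniq, ← hY, hθ] at hcomb
  rw [hzθ]
  push_cast
  rw [← hcomb]
  ring

/-! ### Double points of the cubic x and transversality -/

theorem eval_sin_three_sub_four (α : ℝ) :
    (C 3 * X - C 4 * X ^ 3 : ℝ[X]).eval (Real.sin α) = Real.sin (3 * α) := by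
  rw [Real.sin_three_mul]
  simp

/-- Cancelling b - a leaves the ellipse 3(a + b)² + (b - a)² = 3, parametrized by sin θ = a + b and
cos θ = (b - a)/√3; as a ≠ b, |a + b| < 1. -/
theorem exists_angle_of_eval_eq {a b : ℝ} (hab : a < b)
    (h : (C 3 * X - C 4 * X ^ 3 : ℝ[X]).eval a = (C 3 * X - C 4 * X ^ 3 : ℝ[X]).eval b) :
    ∃ θ ∈ Ioo (-(Real.pi / 2)) (Real.pi / 2),
      a = Real.sin (θ - Real.pi / 3) ∧ b = Real.sin (θ + Real.pi / 3) := by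
  have h1 : 4 * (a ^ 2 + a * b + b ^ 2) = 3 := by
    have h2 : (b - a) * (3 - 4 * (a ^ 2 + a * b + b ^ 2)) = 0 := by
      simp only [eval_sub, eval_mul, eval_C, eval_X, eval_pow] at h
      linear_combination -h
    have := (mul_eq_zero.1 h2).resolve_left (sub_pos.2 hab).ne'
    linarith
  have h3 : (Real.sqrt 3) ^ 2 = 3 := Real.sq_sqrt (by norm_num)
  have h3pos : 0 < Real.sqrt 3 := Real.sqrt_pos.2 (by norm_num)
  have hlt : (a + b) ^ 2 < 1 := by nlinarith [mul_pos (sub_pos.2 hab) (sub_pos.2 hab)]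
  have hlt' := abs_lt.1 ((sq_lt_one_iff_abs_lt_one _).1 hlt)
  have hcos : Real.cos (Real.arcsin (a + b)) = (b - a) / Real.sqrt 3 := by
    rw [Real.cos_arcsin, ← Real.sqrt_sq (div_pos (sub_pos.2 hab) h3pos).le]
    congr 1
    rw [div_pow, h3]
    linarith
  have hsin := Real.sin_arcsin hlt'.1.le hlt'.2.le
  refine ⟨Real.arcsin (a + b), ⟨Real.neg_pi_div_two_lt_arcsin.2 hlt'.1,
    Real.arcsin_lt_pi_div_two.2 hlt'.2⟩, ?_, ?_⟩
  · rw [Real.sin_sub, hsin, hcos, Real.cos_pi_div_three, Real.sin_pi_div_three]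
    field_simp
    ring
  · rw [Real.sin_add, hsin, hcos, Real.cos_pi_div_three, Real.sin_pi_div_three]
    field_simp
    ring

/-- At both angles θ ± π/3, x'(sin α) cos α = -3 cos 3θ. Hence the determinant times cos(θ - π/3)
cos(θ + π/3) is -3d cos 3θ, which is nonzero. -/
theorem transverseAt_of_hasDerivAt (y : ℝ[X]) (θ d : ℝ) (hd : d ≠ 0) (hc : Real.cos (3 * θ) ≠ 0)
    (h : HasDerivAt (fun θ ↦ y.eval (Real.sin (θ + Real.pi / 3)) -
      y.eval (Real.sin (θ - Real.pi / 3))) d θ) :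
    TransverseAt (C 3 * X - C 4 * X ^ 3) y (Real.sin (θ - Real.pi / 3))
      (Real.sin (θ + Real.pi / 3)) := by
  have hsinder : ∀ c, HasDerivAt (fun θ ↦ Real.sin (θ + c)) (Real.cos (θ + c)) θ := by
    intro c
    have := ((hasDerivAt_id θ).add_const c).sin
    rwa [mul_one] at this
  have hyder : ∀ c, HasDerivAt (fun θ ↦ y.eval (Real.sin (θ + c)))
      (y.derivative.eval (Real.sin (θ + c)) * Real.cos (θ + c)) θ := fun c ↦
    HasDerivAt.comp (h₂ := fun t ↦ y.eval t) θ (y.hasDerivAt (Real.sin (θ + c))) (hsinder c)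
  have hd' := h.unique ((hyder (Real.pi / 3)).sub (hyder (-(Real.pi / 3))))
  have hx : ∀ α, (C 3 * X - C 4 * X ^ 3 : ℝ[X]).derivative.eval (Real.sin α) * Real.cos α =
      3 * Real.cos (3 * α) := by
    intro α
    rw [Real.cos_three_mul]
    simp only [derivative_sub, derivative_C_mul, derivative_X, derivative_X_pow, eval_sub, eval_mul,
      eval_C, eval_one, eval_pow, eval_X]
    have := Real.sin_sq_add_cos_sq α
    push_cast
    norm_num
    linear_combination (-12 * Real.cos α) * this
  have hx1 := hx (θ - Real.pi / 3)
  have hx2 := hx (θ + Real.pi / 3)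
  rw [show 3 * (θ - Real.pi / 3) = 3 * θ - Real.pi by ring, Real.cos_sub_pi] at hx1
  rw [show 3 * (θ + Real.pi / 3) = 3 * θ + Real.pi by ring, Real.cos_add_pi] at hx2
  rw [← sub_eq_add_neg] at hd'
  intro hE
  have hzero : Real.cos (3 * θ) * d = 0 := by
    rw [hd']
    linear_combination (-(1 / 3) * Real.cos (θ - Real.pi / 3) * Real.cos (θ + Real.pi / 3)) * hE +
      (1 / 3) * (y.derivative.eval (Real.sin (θ + Real.pi / 3)) * Real.cos (θ + Real.pi / 3)) * hx1 -
      (1 / 3) * (y.derivative.eval (Real.sin (θ - Real.pi / 3)) * Real.cos (θ - Real.pi / 3)) * hx2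
  exact (mul_ne_zero hc hd) hzero

/-! ### Assembling the curve -/

theorem proposition4 (N : ℕ) (hN : Odd N) :
    ∃ x y z : ℝ[X],
      x.natDegree = 3 ∧
      y.natDegree = N + 2 * (N / 4) + 1 ∧
      z.natDegree = N + 2 * ((N + 1) / 4) ∧
      (crossingPoints x y).ncard = N ∧
      ∃ s t : Fin N → ℝ,
        StrictMono s ∧ StrictMono t ∧ (∀ i j, s i < t j) ∧
        (∀ a b : ℝ, a < b →
          (planePoint x y a = planePoint x y b ↔ ∃ i, a = s i ∧ b = t i)) ∧
        (∀ i, TransverseAt x y (s i) (t i)) ∧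
        ∀ i : Fin N, 0 < (-1 : ℝ) ^ ((i : ℕ) + 1) * (z.eval (t i) - z.eval (s i)) := by
  obtain ⟨n, hn⟩ := hN
  obtain ⟨D, hD, hDN, hDN'⟩ : ∃ D, ((Even n ∧ D = 3 * n + 2) ∨ (Odd n ∧ D = 3 * n + 1)) ∧
      D = N + 2 * (N / 4) + 1 ∧ 6 * n + 3 - D = N + 2 * ((N + 1) / 4) := by
    rcases Nat.even_or_odd n with h | h
    · exact ⟨3 * n + 2, Or.inl ⟨h, rfl⟩, by obtain ⟨k, hk⟩ := h; omega,
        by obtain ⟨k, hk⟩ := h; omega⟩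
    · exact ⟨3 * n + 1, Or.inr ⟨h, rfl⟩, by obtain ⟨k, hk⟩ := h; omega,
        by obtain ⟨k, hk⟩ := h; omega⟩
  obtain ⟨y, z, Y, S, hy, hz, hS, hSδ, hall, hsimple, hyY, hzY⟩ := exists_height_polynomials n D hD
  rw [← hn] at hS
  let u : Fin N → ℝ := S.orderEmbOfFin hS
  have humono : StrictMono u := (S.orderEmbOfFin hS).strictMono
  have huS : ∀ i, u i ∈ S := fun i ↦ S.orderEmbOfFin_mem hS i
  have huex : ∀ v ∈ S, ∃ i, u i = v := fun v hv ↦ by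
    have : v ∈ Set.range u := by
      rw [show Set.range u = (S : Set ℝ) from S.range_orderEmbOfFin hS]
      exact hv
    exact this
  have hu : ∀ i, u i ∈ Ioo (-(1 / 2) : ℝ) (1 / 2) := fun i ↦ abs_lt.1 (hSδ _ (huS i))
  let θ : Fin N → ℝ := fun i ↦ Real.arcsin (u i)
  have hsinθ : ∀ i, Real.sin (θ i) = u i := fun i ↦
    Real.sin_arcsin (by linarith [(hu i).1]) (by linarith [(hu i).2])
  have hpi := Real.pi_pos
  -- The bound 1/2 = sin(π/6) puts θ ± π/3 in (-π/2, π/2), where sin increases, with all θ_i - π/3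
  -- below all θ_j + π/3; it also makes cos 3θ positive.
  have hθ : ∀ i, θ i ∈ Ioo (-(Real.pi / 6)) (Real.pi / 6) := fun i ↦ by
    have h6 : Real.pi / 6 ∈ Icc (-(Real.pi / 2)) (Real.pi / 2) := ⟨by linarith, by linarith⟩
    have h6' : -(Real.pi / 6) ∈ Icc (-(Real.pi / 2)) (Real.pi / 2) := ⟨by linarith, by linarith⟩
    constructor
    · rw [← Real.arcsin_sin h6'.1 h6'.2, Real.sin_neg, Real.sin_pi_div_six]
      exact Real.strictMonoOn_arcsin ⟨by norm_num, by norm_num⟩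
        ⟨by linarith [(hu i).1], by linarith [(hu i).2]⟩ (hu i).1
    · rw [← Real.arcsin_sin h6.1 h6.2, Real.sin_pi_div_six]
      exact Real.strictMonoOn_arcsin ⟨by linarith [(hu i).1], by linarith [(hu i).2]⟩
        ⟨by norm_num, by norm_num⟩ (hu i).2
  have hθmono : StrictMono θ := fun i j hij ↦ Real.strictMonoOn_arcsin
    ⟨by linarith [(hu i).1], by linarith [(hu i).2]⟩
    ⟨by linarith [(hu j).1], by linarith [(hu j).2]⟩ (humono hij)
  have hY0 : ∀ i, Y.eval (Real.sin (θ i)) = 0 := fun i ↦ by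
    rw [hsinθ]
    exact (hsimple _ (huS i)).1
  have hcos3 : ∀ i, 0 < Real.cos (3 * θ i) := fun i ↦
    Real.cos_pos_of_mem_Ioo ⟨by linarith [(hθ i).1], by linarith [(hθ i).2]⟩
  have hcos : ∀ i, 0 < Real.cos (θ i) := fun i ↦
    Real.cos_pos_of_mem_Ioo ⟨by linarith [(hθ i).1], by linarith [(hθ i).2]⟩
  obtain ⟨σ, hσ, hsign⟩ := exists_sign_alternating (fun i ↦ Y.derivative.eval (u i))
    (fun i ↦ (hsimple _ (huS i)).2) (fun i hi ↦ by
      refine derivative_eval_mul_neg_of_consecutive_roots Y (humono (Nat.lt_succ_self i))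
        (hsimple _ (huS _)).1 (hsimple _ (huS _)).1 (hsimple _ (huS _)).2 (hsimple _ (huS _)).2
        fun v hv hv0 ↦ ?_
      have hv1 := (hu ⟨i, by omega⟩).1
      have hv2 := (hu ⟨i + 1, hi⟩).2
      obtain ⟨j, rfl⟩ := huex v (hall v ⟨by linarith [hv.1], by linarith [hv.2]⟩ hv0)
      have h1 := humono.lt_iff_lt.1 hv.1
      have h2 := humono.lt_iff_lt.1 hv.2
      rw [Fin.lt_def] at h1 h2
      simp only at h1 h2
      omega)
  set x : ℝ[X] := C 3 * X - C 4 * X ^ 3 with hx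
  have hxdeg : x.natDegree = 3 := by
    rw [hx]
    compute_degree!
  let s : Fin N → ℝ := fun i ↦ Real.sin (θ i - Real.pi / 3)
  let t : Fin N → ℝ := fun i ↦ Real.sin (θ i + Real.pi / 3)
  have hst : ∀ i j, s i < t j := fun i j ↦ by
    refine Real.strictMonoOn_sin ⟨?_, ?_⟩ ⟨?_, ?_⟩ ?_ <;>
      linarith [(hθ i).1, (hθ i).2, (hθ j).1, (hθ j).2]
  have hcross : ∀ a b : ℝ, a < b →
      (planePoint x y a = planePoint x y b ↔ ∃ i, a = s i ∧ b = t i) := by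
    intro a b hab
    simp only [planePoint, Prod.mk.injEq]
    constructor
    · rintro ⟨h1, h2⟩
      obtain ⟨φ, hφ, rfl, rfl⟩ := exists_angle_of_eval_eq hab h1
      have h3 := hyY φ
      rw [h2, sub_self] at h3
      have h4 := (mul_eq_zero.1 h3.symm).resolve_left (Real.cos_pos_of_mem_Ioo hφ).ne'
      obtain ⟨i, hi⟩ := huex _ (hall _ ⟨Real.neg_one_le_sin φ, Real.sin_le_one φ⟩ h4)
      have hφi : θ i = φ := by
        simp only [θ]
        rw [hi, Real.arcsin_sin hφ.1.le hφ.2.le]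
      exact ⟨i, by simp only [s, hφi], by simp only [t, hφi]⟩
    · rintro ⟨i, rfl, rfl⟩
      constructor
      · simp only [s, t, hx]
        rw [eval_sin_three_sub_four, eval_sin_three_sub_four, mul_sub, mul_add,
          mul_div_cancel₀ _ (three_ne_zero' ℝ), Real.sin_sub_pi, Real.sin_add_pi]
      · have h3 := hyY (θ i)
        rw [hY0, mul_zero] at h3
        exact (sub_eq_zero.1 h3).symm
  have hcrossing : ∀ i, planePoint x y (s i) = planePoint x y (t i) := fun i ↦
    (hcross _ _ (hst i i)).2 ⟨i, rfl, rfl⟩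
  -- If s_i < s_j gave the same point, s_j would be some t_l, but every s lies below every t.
  have hinj : Function.Injective fun i ↦ planePoint x y (s i) := by
    have hne : ∀ i j, s i < s j → planePoint x y (s i) ≠ planePoint x y (s j) := fun i j hij h ↦ by
      obtain ⟨l, -, hl⟩ := (hcross _ _ hij).1 h
      exact (hst j l).ne hl
    intro i j hij
    have hsij : s i = s j := by
      rcases lt_trichotomy (s i) (s j) with h | h | h
      · exact absurd hij (hne i j h)
      · exact h
      · exact absurd hij.symm (hne j i h)
    have hθij := Real.injOn_sin ⟨by linarith [(hθ i).1], by linarith [(hθ i).2]⟩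
      ⟨by linarith [(hθ j).1], by linarith [(hθ j).2]⟩ hsij
    exact hθmono.injective (sub_left_injective hθij)
  have hset : crossingPoints x y = Set.range fun i ↦ planePoint x y (s i) := by
    ext p
    constructor
    · rintro ⟨a, b, hab, ha, hb⟩
      rcases hab.lt_or_gt with h | h
      · obtain ⟨i, rfl, -⟩ := (hcross _ _ h).1 (ha.trans hb.symm)
        exact ⟨i, ha⟩
      · obtain ⟨i, rfl, -⟩ := (hcross _ _ h).1 (hb.trans ha.symm)
        exact ⟨i, hb⟩
    · rintro ⟨i, rfl⟩
      exact ⟨s i, t i, (hst i i).ne, rfl, (hcrossing i).symm⟩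
  -- Rescaling z by -σ fixes the sign of the alternation; the minus sign accounts for indices of
  -- `Fin N` starting at 0.
  refine ⟨x, y, C (-σ) * z, hxdeg, hy.trans hDN, ?_, ?_, s, t, ?_, ?_, hst, hcross, ?_, ?_⟩
  · rw [natDegree_C_mul (neg_ne_zero.2 hσ), hz, hDN']
  · rw [hset, ← Set.image_univ, Set.ncard_image_of_injective _ hinj, Set.ncard_univ, Nat.card_fin]
  · intro i j hij
    have := hθmono hij
    refine Real.strictMonoOn_sin ⟨?_, ?_⟩ ⟨?_, ?_⟩ ?_ <;>
      linarith [(hθ i).1, (hθ i).2, (hθ j).1, (hθ j).2]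
  · intro i j hij
    have := hθmono hij
    refine Real.strictMonoOn_sin ⟨?_, ?_⟩ ⟨?_, ?_⟩ ?_ <;>
      linarith [(hθ i).1, (hθ i).2, (hθ j).1, (hθ j).2]
  · intro i
    have hder := (Real.hasDerivAt_cos (θ i)).mul (HasDerivAt.comp (θ i)
      (Y.hasDerivAt (Real.sin (θ i))) (Real.hasDerivAt_sin (θ i)))
    refine transverseAt_of_hasDerivAt y (θ i) _ ?_ (hcos3 i).ne'
      (hder.congr_of_eventuallyEq (Eventually.of_forall hyY))
    simp only [Function.comp]
    rw [hY0, mul_zero, zero_add, hsinθ]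
    exact mul_ne_zero (hcos i).ne' (mul_ne_zero (hsimple _ (huS i)).2 (hcos i).ne')
  · intro i
    have h1 := hzY (θ i) (hY0 i)
    rw [hsinθ] at h1
    have h2 : 0 < Real.cos (3 * θ i) * Real.cos (θ i) ^ 2 :=
      mul_pos (hcos3 i) (pow_pos (hcos i) 2)
    have h3 := mul_pos h2 (hsign i)
    simp only [s, t, eval_mul, eval_C, ← mul_sub]
    rw [h1, pow_succ]
    linarith
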